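/- Let $G$ be a countable discrete group and let $G\curvearrowright X$ be a free minimal action by homeomorphisms on a metric space $X$ homeomorphic to the Cantor set. Let $M_G(X)$ be the set of $G$-invariant regular Borel probability measures on $X$ and $E_G(X)$ its set of extreme points (the ergodic measures). For $m\in\{0,1,2,\dots\}$ and $A,B\subseteq X$ write $A\prec_m B$ if for every closed $C\subseteq A$ there are a finite collection $\mathcal U$ of open subsets of $X$ covering $C$, elements $s_U\in G$ ($U\in\mathcal U$), and a partition $\mathcal U=\mathcal U_0\sqcup\dots\sqcup\mathcal U_m$ such that for each $i$ the sets $s_UU$, $U\in\mathcal U_i$, are pairwise disjoint subsets of $B$; write $\prec$ for $\prec_0$. The action has $m$-comparison if $A\prec_m B$ for all nonempty open $A,B\subseteq X$ with $\mu(A)<\mu(B)$ for every $\mu\in M_G(X)$; comparison means $0$-comparison. A finite set $F\subseteq G$ is $(K,\delta)$-invariant if $|tF\,\Delta\,F|\le\delta|F|$ for all $t\in K$; $G$ is amenable if for every finite $K\subseteq G$ and $\delta>0$ there is a nonempty $(K,\delta)$-invariant finite set. The action is almost finite if for every integer $n\ge 1$, finite $K\subseteq G$ and $\delta>0$ there are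 finitely many open sets $V_i\subseteq X$ and $(K,\delta)$-invariant finite sets $S_i\subseteq G$ such that all the levels $sV_i$ ($i\in I$, $s\in S_i$) are pairwise disjoint and of diameter less than $\delta$, and sets $S_i'\subseteq S_i$ with $|S_i'|<|S_i|/n$ and $X\setminus\bigsqcup_i S_iV_i\prec\bigsqcup_i S_i'V_i$. The clopen type semigroup $S(X,G)$ is the quotient of the additive semigroup $C(X,\mathbb Z_{\ge0})$ by the relation $f\sim g$ if there are $h_1,\dots,h_n\in C(X,\mathbb Z_{\ge0})$ and $s_1,\dots,s_n\in G$ with $\sum_i h_i=f$ and $\sum_i\alpha_{s_i}(h_i)=g$, where $\alpha_s(h)(x)=h(s^{-1}x)$; it is ordered by $a\le b$ iff $a+c=b$ for some $c\in S(X,G)$. It is almost unperforated if $(n+1)a\le nb$ implies $a\le b$ for all $a,b\in S(X,G)$ and integers $n\ge1$. Consider the conditions: (i) the action is almost finite; (ii) $S(X,G)$ is almost unperforated; (iii) the action has comparison; (iv) the action has $m$-comparison for all $m\ge 0$; (v) the action has $m$-comparison for some $m\ge0$. Then (i)$\Rightarrow$(ii)$\Rightarrow$(iii)$\Rightarrow$(iv)$\Rightarrow$(v).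 If moreover $G$ is amenable and $E_G(X)$ is finite, then all five conditions are equivalent. -/

import Mathlib

open MeasureTheory
open scoped Pointwise NNReal symmDiff

namespace CantorComparison

/-! ### Amenability -/

section Groups

variable {G : Type*} [Group G]

open scoped Classical in
/-- A finite set `F` is `(K, δ)`-invariant if `|tF ∆ F| ≤ δ |F|` for every `t ∈ K`. -/
def IsInvariantShape (K : Finset G) (δ : ℝ) (F : Finset G) : Prop :=
  ∀ t ∈ K, (((t • F) ∆ F).card : ℝ) ≤ δ * F.card

variable (G) in
/-- Amenability of a discrete group: for every finite `K` and `δ > 0` there is a nonempty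
`(K, δ)`-invariant finite set. -/
def IsAmenable : Prop :=
  ∀ (K : Finset G) (δ : ℝ), 0 < δ → ∃ F : Finset G, F.Nonempty ∧ IsInvariantShape K δ F

end Groups

/-! ### Comparison -/

section Comparison

variable (G : Type*) [Group G] {X : Type*} [TopologicalSpace X] [MulAction G X]

/-- The relation `A ≺_m B`. The map `c` encodes the partition `𝒰 = 𝒰₀ ⊔ ⋯ ⊔ 𝒰ₘ`. -/
def Subequiv (m : ℕ) (A B : Set X) : Prop :=
  ∀ C : Set X, IsClosed C → C ⊆ A →
    ∃ 𝒰 : Set (Set X), 𝒰.Finite ∧ (∀ U ∈ 𝒰, IsOpen U) ∧ C ⊆ ⋃₀ 𝒰 ∧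
      ∃ (s : Set X → G) (c : Set X → Fin (m + 1)),
        (∀ U ∈ 𝒰, s U • U ⊆ B) ∧
        ∀ U ∈ 𝒰, ∀ V ∈ 𝒰, U ≠ V → c U = c V → Disjoint (s U • U) (s V • V)

variable (X)

/-- `M_G(X)`: the `G`-invariant regular Borel probability measures on `X`. -/
def invariantMeasures [MeasurableSpace X] : Set (Measure X) :=
  {μ | IsProbabilityMeasure μ ∧ μ.Regular ∧ SMulInvariantMeasure G X μ}

/-- `E_G(X)`: the extreme points of the convex set `M_G(X)`. -/
def ergodicMeasures [MeasurableSpace X] : Set (Measure X) :=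
  (invariantMeasures G X).extremePoints ℝ≥0

/-- `m`-comparison. -/
def HasMComparison [MeasurableSpace X] (m : ℕ) : Prop :=
  ∀ A B : Set X, IsOpen A → IsOpen B → A.Nonempty → B.Nonempty →
    (∀ μ ∈ invariantMeasures G X, μ A < μ B) → Subequiv G m A B

/-- Comparison, i.e. `0`-comparison. -/
def HasComparison [MeasurableSpace X] : Prop := HasMComparison G X 0

end Comparison

/-! ### Almost finiteness -/

section AlmostFinite

variable {G : Type*} [Group G] {X : Type*} [MulAction G X]

/-- The set `SV = {sx : s ∈ S, x ∈ V}`. -/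
def towerUnion (S : Finset G) (V : Set X) : Set X := ⋃ s ∈ S, s • V

/-- `(V, S)` is a tower: the levels `sV`, `s ∈ S`, are pairwise disjoint. -/
def IsTower (V : Set X) (S : Finset G) : Prop :=
  ∀ s ∈ S, ∀ t ∈ S, s ≠ t → Disjoint (s • V) (t • V)

/-- A castle: finitely many towers `(V i, S i)` for which the sets `S i V i` are pairwise
disjoint. -/
def IsCastle {k : ℕ} (V : Fin k → Set X) (S : Fin k → Finset G) : Prop :=
  (∀ i, IsTower (V i) (S i)) ∧
    ∀ i j, i ≠ j → Disjoint (towerUnion (S i) (V i)) (towerUnion (S j) (V j))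

variable (G X) in
/-- Almost finiteness of an action on a compact metric space. -/
def AlmostFinite [MetricSpace X] : Prop :=
  ∀ (n : ℕ) (K : Finset G) (δ : ℝ), 0 < n → 0 < δ →
    ∃ (k : ℕ) (V : Fin k → Set X) (S : Fin k → Finset G),
      IsCastle V S ∧ (∀ i, IsOpen (V i)) ∧
      (∀ i, IsInvariantShape K δ (S i)) ∧
      (∀ i, ∀ s ∈ S i, Metric.diam (s • V i) < δ) ∧
      ∃ S' : Fin k → Finset G,
        (∀ i, S' i ⊆ S i) ∧ (∀ i, ((S' i).card : ℝ) < (S i).card / n) ∧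
        Subequiv G 0 (⋃ i, towerUnion (S i) (V i))ᶜ (⋃ i, towerUnion (S' i) (V i))

end AlmostFinite

/-! ### The clopen type semigroup -/

section TypeSemigroup

/-- Almost unperforation of an ordered abelian semigroup. -/
def AlmostUnperforated (A : Type*) [AddCommMonoid A] [LE A] : Prop :=
  ∀ (a b : A) (n : ℕ), 0 < n → (n + 1) • a ≤ n • b → a ≤ b

variable {G : Type*} [Group G] {X : Type*} [TopologicalSpace X] [MulAction G X]
  [ContinuousConstSMul G X]

/-- The induced action `α_s(f)(x) = f(s⁻¹x)` on `C(X, ℤ_{≥0})`. -/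
def translate (s : G) : C(X, ℕ) →+ C(X, ℕ) where
  toFun f := ⟨fun x => f (s⁻¹ • x), f.continuous.comp (continuous_const_smul _)⟩
  map_zero' := rfl
  map_add' _ _ := rfl

theorem translate_apply (s : G) (f : C(X, ℕ)) (x : X) : translate s f x = f (s⁻¹ • x) := rfl

theorem translate_translate (s t : G) (f : C(X, ℕ)) :
    translate s (translate t f) = translate (s * t) f := by
  ext x
  simp [translate_apply, mul_smul]

theorem translate_one (f : C(X, ℕ)) : translate (1 : G) f = f := by
  ext x
  simp [translate_apply]

variable (G) in
/-- `f ∼ g`: there are `h_i` and `s_i` with `∑ h_i = f` and `∑ α_{s_i}(h_i) = g`. -/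
def TypeRel (f g : C(X, ℕ)) : Prop :=
  ∃ (n : ℕ) (h : Fin n → C(X, ℕ)) (s : Fin n → G),
    ∑ i, h i = f ∧ ∑ i, translate (s i) (h i) = g

theorem TypeRel.of_fintype {ι : Type*} [Fintype ι] {f g : C(X, ℕ)} (h : ι → C(X, ℕ))
    (s : ι → G) (hf : ∑ i, h i = f) (hg : ∑ i, translate (s i) (h i) = g) : TypeRel G f g := by
  refine ⟨Fintype.card ι, h ∘ (Fintype.equivFin ι).symm, s ∘ (Fintype.equivFin ι).symm, ?_, ?_⟩
  · rw [← hf]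
    exact (Fintype.equivFin ι).symm.sum_comp h
  · rw [← hg]
    exact (Fintype.equivFin ι).symm.sum_comp fun i => translate (s i) (h i)

theorem sum_sigma_ite {ι : Type*} [Fintype ι] [DecidableEq ι] (a : ι → ℕ) (i : ι) :
    ∑ p : Σ i, Fin (a i), (if p.1 = i then 1 else 0) = a i := by
  rw [Fintype.sum_sigma]
  simp [apply_ite Finset.card]

/-- Riesz refinement in `ℕ`. -/
theorem exists_refinement {ι κ : Type*} [Fintype ι] [Fintype κ] (a : ι → ℕ) (b : κ → ℕ) :
    ∃ c : ι → κ → ℕ, ∑ i, a i = ∑ j, b j →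
      (∀ i, ∑ j, c i j = a i) ∧ ∀ j, ∑ i, c i j = b j := by
  classical
  by_cases hab : ∑ i, a i = ∑ j, b j
  swap
  · exact ⟨0, fun h => absurd h hab⟩
  have e : (Σ i, Fin (a i)) ≃ Σ j, Fin (b j) :=
    Fintype.equivOfCardEq (by simpa using hab)
  refine ⟨fun i j => ∑ p : Σ i, Fin (a i), if p.1 = i ∧ (e p).1 = j then 1 else 0,
    fun _ => ⟨fun i => ?_, fun j => ?_⟩⟩
  · rw [Finset.sum_comm]
    have h1 : ∀ p : Σ i, Fin (a i),
        ∑ j, (if p.1 = i ∧ (e p).1 = j then 1 else 0) = if p.1 = i then 1 else 0 := by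
      intro p
      simp [ite_and]
    simp only [h1]
    exact sum_sigma_ite a i
  · rw [Finset.sum_comm]
    have h1 : ∀ p : Σ i, Fin (a i),
        ∑ i, (if p.1 = i ∧ (e p).1 = j then 1 else 0) = if (e p).1 = j then 1 else 0 := by
      intro p
      simp [ite_and]
    simp only [h1]
    rw [e.sum_comp fun q : Σ j, Fin (b j) => if q.1 = j then 1 else 0]
    exact sum_sigma_ite b j

theorem TypeRel.refl (f : C(X, ℕ)) : TypeRel G f f :=
  TypeRel.of_fintype (ι := Unit) (fun _ => f) (fun _ => 1) (by simp) (by simp [translate_one])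

theorem TypeRel.symm {f g : C(X, ℕ)} : TypeRel G f g → TypeRel G g f := by
  rintro ⟨n, h, s, hf, hg⟩
  refine ⟨n, fun i => translate (s i) (h i), fun i => (s i)⁻¹, hg, ?_⟩
  simpa [translate_translate, translate_one] using hf

theorem TypeRel.trans {f g l : C(X, ℕ)} : TypeRel G f g → TypeRel G g l → TypeRel G f l := by
  rintro ⟨n, h, s, hf, hg⟩ ⟨m, k, t, hk, hl⟩
  choose R hR using fun ab : (Fin n → ℕ) × (Fin m → ℕ) => exists_refinement ab.1 ab.2
  let P : X → (Fin n → ℕ) × (Fin m → ℕ) := fun x =>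
    (fun i => translate (s i) (h i) x, fun j => k j x)
  have hP : Continuous P := by fun_prop
  let c : Fin n → Fin m → C(X, ℕ) := fun i j =>
    ⟨fun x => R (P x) i j, (continuous_of_discreteTopology (f := fun p => R p i j)).comp hP⟩
  have hc : ∀ x, (∀ i, ∑ j, c i j x = translate (s i) (h i) x) ∧ ∀ j, ∑ i, c i j x = k j x := by
    intro x
    refine hR (P x) ?_
    have := congrArg (fun u : C(X, ℕ) => u x) (hg.trans hk.symm)
    simpa [ContinuousMap.sum_apply] using this
  have hrow : ∀ i, ∑ j, c i j = translate (s i) (h i) := by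
    intro i
    ext x
    simpa [ContinuousMap.sum_apply] using (hc x).1 i
  have hcol : ∀ j, ∑ i, c i j = k j := by
    intro j
    ext x
    simpa [ContinuousMap.sum_apply] using (hc x).2 j
  refine TypeRel.of_fintype (ι := Fin n × Fin m) (fun p => translate (s p.1)⁻¹ (c p.1 p.2))
    (fun p => t p.2 * s p.1) ?_ ?_
  · rw [Fintype.sum_prod_type, ← hf]
    refine Finset.sum_congr rfl fun i _ => ?_
    dsimp only
    rw [← map_sum, hrow, translate_translate, inv_mul_cancel, translate_one]
  · rw [Fintype.sum_prod_type_right, ← hl]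
    refine Finset.sum_congr rfl fun j _ => ?_
    simp only [translate_translate, mul_inv_cancel_right]
    rw [← map_sum, hcol]

theorem TypeRel.add {f g f' g' : C(X, ℕ)} :
    TypeRel G f g → TypeRel G f' g' → TypeRel G (f + f') (g + g') := by
  rintro ⟨n, h, s, hf, hg⟩ ⟨m, k, t, hk, hl⟩
  exact TypeRel.of_fintype (ι := Fin n ⊕ Fin m) (Sum.elim h k) (Sum.elim s t)
    (by simp [hf, hk]) (by simp [hg, hl])

variable (G X)

/-- The relation `∼` as a congruence on the additive monoid `C(X, ℤ_{≥0})`. -/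
def typeCon : AddCon C(X, ℕ) where
  r := TypeRel G
  iseqv := ⟨TypeRel.refl, TypeRel.symm, TypeRel.trans⟩
  add' := TypeRel.add

/-- The clopen type semigroup `S(X, G) = C(X, ℤ_{≥0}) / ∼`. -/
def TypeSemigroup : Type _ := (typeCon G X).Quotient

instance : AddCommMonoid (TypeSemigroup G X) :=
  inferInstanceAs (AddCommMonoid (typeCon G X).Quotient)

/-- The algebraic order: `a ≤ b` if `a + c = b` for some `c`. -/
instance : LE (TypeSemigroup G X) := ⟨fun a b => ∃ c, a + c = b⟩

end TypeSemigroup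

end CantorComparison

/-! Three arguments carry the theorem; (iii)⇒(iv)⇒(v) is formal.

(i)⇒(ii). Suppose (n+1)[f] ≤ n[g]. Equidecomposition barely changes sums along Følner sets, so on an
invariant shape S every point satisfies (n+1)∑f ≤ n∑g + o(|S|) (`exists_sum_le_of_mk_le`), and
minimality bounds ∑g below by a fixed proportion of |S| (`exists_card_le_sum`). Hence ∑g exceeds ∑f
by a proportion of |S|. Almost finiteness gives a clopen castle whose remainder fits into few levels
(`AlmostFinite.exists_clopen_castle`). After f and g are collapsed onto the bases of the towers, the
surplus of g pays for the part of f on the remainder.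

(ii)⇒(iii). Hahn–Banach turns the inequality between measures into an algebraic one. Take the closed
cone containing the nonpositive functions, f - g for f ∼ g, and 1_V - 1_A for clopen V ⊆ B, with A
already shrunk to a clopen set. A functional separating 1 from it would be an invariant measure with
μ(V) ≤ μ(A) for all such V, against regularity. So 1 lies in the cone (`one_mem_comparisonCone`),
which yields w + L[A] + [1] ≤ w + L[W] for a clopen W ⊆ B; almost unperforation then gives [A] ≤ [W]
(`AlmostUnperforated.le_of_add_le`).

(v)⇒(i). Freeness and amenability give clopen castles with invariant shapes whose remainder is
uniformly small for all invariant measures (`IsAmenable.exists_isTiled`): each stage adds towers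
that shrink the remainder by a fixed factor. By m-comparison the remainder goes, in m+1 colours,
into a few selected levels. Each of these has m+1 disjoint copies in its tower, one per colour, so a
single colour suffices (`Subequiv.spread`). -/

namespace CantorComparison

/-! ### Subequivalence from indexed families -/

section Subequivalence

variable {G : Type*} [Group G] {X : Type*} [TopologicalSpace X] [MulAction G X]

/-- A finite indexed cover of `A` witnesses `A ≺_m B`. -/
theorem Subequiv.of_family {ι : Type*} [Finite ι] {m : ℕ} {A B : Set X} (U : ι → Set X)
    (s : ι → G) (c : ι → Fin (m + 1)) (hU : ∀ i, IsOpen (U i)) (hA : A ⊆ ⋃ i, U i)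
    (hB : ∀ i, s i • U i ⊆ B)
    (hd : ∀ i j, i ≠ j → c i = c j → Disjoint (s i • U i) (s j • U j)) : Subequiv G m A B := by
  classical
  intro C _ hCA
  rcases isEmpty_or_nonempty ι with hι | hι
  · refine ⟨∅, Set.finite_empty, by simp, ?_, fun _ => 1, fun _ => 0, by simp, by simp⟩
    simpa using hCA.trans hA
  choose! e he using fun (V : Set X) (hV : V ∈ Set.range U) => hV
  refine ⟨Set.range U, Set.finite_range U, ?_, ?_, s ∘ e, c ∘ e, ?_, ?_⟩
  · rintro _ ⟨i, rfl⟩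
    exact hU i
  · rw [Set.sUnion_range]
    exact hCA.trans hA
  · intro V hV
    have := hB (e V)
    rwa [he V hV] at this
  · intro V hV W hW hne hc
    have := hd (e V) (e W) (fun h => hne (by rw [← he V hV, ← he W hW, h])) hc
    rwa [he V hV, he W hW] at this

theorem Subequiv.of_zero {m : ℕ} {A B : Set X} (h : Subequiv G 0 A B) : Subequiv G m A B := by
  intro C hC hCA
  obtain ⟨𝒰, hfin, ho, hc, s, c, hs, hd⟩ := h C hC hCA
  exact ⟨𝒰, hfin, ho, hc, s, fun _ => 0, hs,
    fun U hU V hV hne _ => hd U hU V hV hne (Fin.ext (by omega))⟩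

theorem HasComparison.hasMComparison [MeasurableSpace X] (h : HasComparison G X) (m : ℕ) :
    HasMComparison G X m :=
  fun A B hA hB hA' hB' hμ => (h A B hA hB hA' hB' hμ).of_zero

end Subequivalence

/-! ### Indicators of clopen sets -/

section Indicator

variable {X : Type*} [TopologicalSpace X]

/-- The indicator function of a clopen set. -/
noncomputable def clopenIndicator {U : Set X} (hU : IsClopen U) : C(X, ℕ) :=
  ⟨U.indicator 1, continuous_one.indicator (by simp [hU.frontier_eq])⟩

theorem clopenIndicator_apply {U : Set X} (hU : IsClopen U) (x : X) :
    clopenIndicator hU x = U.indicator 1 x := rfl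

theorem clopenIndicator_of_mem {U : Set X} (hU : IsClopen U) {x : X} (hx : x ∈ U) :
    clopenIndicator hU x = 1 := by simp [clopenIndicator_apply, hx]

theorem clopenIndicator_of_notMem {U : Set X} (hU : IsClopen U) {x : X} (hx : x ∉ U) :
    clopenIndicator hU x = 0 := by simp [clopenIndicator_apply, hx]

theorem isClopen_support (f : C(X, ℕ)) : IsClopen {x | f x ≠ 0} :=
  (isClopen_discrete {n : ℕ | n ≠ 0}).preimage f.continuous

theorem exists_nat_bound [CompactSpace X] (f : C(X, ℕ)) : ∃ N, ∀ x, f x ≤ N := by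
  obtain ⟨N, hN⟩ := (isCompact_range f.continuous).bddAbove
  exact ⟨N, fun x => hN ⟨x, rfl⟩⟩

end Indicator

/-! ### Order and cancellation in the type semigroup -/

section TypeSemigroupOrder

variable (G : Type*) [Group G] {X : Type*} [TopologicalSpace X] [MulAction G X]
  [ContinuousConstSMul G X]

/-- The class in the clopen type semigroup. -/
def TypeSemigroup.mk : C(X, ℕ) →+ TypeSemigroup G X := (typeCon G X).mk'

theorem TypeSemigroup.mk_eq {f g : C(X, ℕ)} : mk G f = mk G g ↔ TypeRel G f g :=
  (typeCon G X).eq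

theorem TypeSemigroup.mk_surjective : Function.Surjective (mk G (X := X)) :=
  (typeCon G X).mk'_surjective

instance : Preorder (TypeSemigroup G X) where
  le_refl a := ⟨0, add_zero a⟩
  le_trans := by
    rintro a _ _ ⟨c, rfl⟩ ⟨d, rfl⟩
    exact ⟨c + d, (add_assoc a c d).symm⟩

instance : IsOrderedAddMonoid (TypeSemigroup G X) where
  add_le_add_left := by
    rintro a _ ⟨c, rfl⟩ d
    exact ⟨c, add_right_comm a d c⟩

theorem TypeSemigroup.mk_mono {f g : C(X, ℕ)} (h : ∀ x, f x ≤ g x) : mk G f ≤ mk G g := by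
  refine ⟨mk G ⟨fun x => g x - f x, by fun_prop⟩, ?_⟩
  rw [← map_add]
  congr 1
  ext x
  exact Nat.add_sub_cancel' (h x)

theorem TypeSemigroup.mk_translate (s : G) (f : C(X, ℕ)) : mk G (translate s f) = mk G f :=
  ((mk_eq G).2 (TypeRel.of_fintype (ι := Unit) (fun _ => f) (fun _ => s) (by simp)
    (by simp))).symm

theorem TypeSemigroup.mk_le_iff {f g : C(X, ℕ)} :
    mk G f ≤ mk G g ↔ ∃ c, TypeRel G (f + c) g := by
  constructor
  · rintro ⟨c, hc⟩
    obtain ⟨c, rfl⟩ := mk_surjective G c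
    exact ⟨c, (mk_eq G).1 (by rw [map_add, hc])⟩
  · rintro ⟨c, hc⟩
    exact ⟨mk G c, by rw [← map_add, (mk_eq G).2 hc]⟩

variable {G}

theorem TypeSemigroup.zero_le (a : TypeSemigroup G X) : 0 ≤ a := ⟨a, zero_add a⟩

/-- A cancellation property of almost unperforated type semigroups. -/
theorem AlmostUnperforated.le_of_add_le (h : AlmostUnperforated (TypeSemigroup G X))
    {w a b u : TypeSemigroup G X} {L c : ℕ} (hle : w + (L • a + u) ≤ w + L • b) (hau : a ≤ u)
    (hw : w ≤ c • b) : a ≤ b := by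
  -- The summand `w` reappears on the right, so the hypothesis can be iterated while only one copy
  -- of `w` is ever needed.
  have key : ∀ k : ℕ, w + k • (L • a + u) ≤ w + (k * L) • b := by
    intro k
    induction k with
    | zero => simp
    | succ k ih =>
      calc w + (k + 1) • (L • a + u) = w + (L • a + u) + k • (L • a + u) := by
            rw [succ_nsmul']; abel
        _ ≤ w + L • b + k • (L • a + u) := by gcongr
        _ = w + k • (L • a + u) + L • b := by abel
        _ ≤ w + (k * L) • b + L • b := by gcongr
        _ = w + ((k + 1) * L) • b := by rw [add_mul, one_mul, add_nsmul, add_assoc]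
  have hb : (0 : TypeSemigroup G X) ≤ b := TypeSemigroup.zero_le b
  -- With `k = c + 2` the left side contains `(c + 2) * (L + 1)` copies of `a`, which is one more
  -- than `(c + 2) * L + (c + 1)`; on the right `w` costs only `c` copies of `b`.
  refine h a b ((c + 2) * L + (c + 1)) (by omega) ?_
  calc ((c + 2) * L + (c + 1) + 1) • a = (c + 2) • (L • a + a) := by
        rw [nsmul_add, ← mul_nsmul', ← add_nsmul]; rfl
    _ ≤ (c + 2) • (L • a + u) := by gcongr
    _ ≤ w + (c + 2) • (L • a + u) := le_add_of_nonneg_left (TypeSemigroup.zero_le w)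
    _ ≤ w + ((c + 2) * L) • b := key _
    _ ≤ c • b + ((c + 2) * L) • b := by gcongr
    _ ≤ (c + 1) • b + ((c + 2) * L) • b := by gcongr; omega
    _ = ((c + 2) * L + (c + 1)) • b := by rw [add_comm, ← add_nsmul]

/-- The supports of the pieces of `1_U + c` cover `U`. The translated pieces add up to `1_V`, which
is at most 1, so their supports are disjoint and lie in `V`. -/
theorem TypeRel.exists_disjoint_family {U V : Set X} (hU : IsClopen U) (hV : IsClopen V)
    (h : TypeSemigroup.mk G (clopenIndicator hU) ≤ TypeSemigroup.mk G (clopenIndicator hV)) :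
    ∃ (n : ℕ) (W : Fin n → Set X) (s : Fin n → G), (∀ i, IsOpen (W i)) ∧ U ⊆ ⋃ i, W i ∧
      (∀ i, s i • W i ⊆ V) ∧ ∀ i j, i ≠ j → Disjoint (s i • W i) (s j • W j) := by
  obtain ⟨c, n, k, s, hk, hs⟩ := (TypeSemigroup.mk_le_iff G).1 h
  have hsum : ∀ x, ∑ i, k i ((s i)⁻¹ • x) = V.indicator 1 x := fun x => by
    simpa [ContinuousMap.sum_apply, translate_apply, clopenIndicator_apply] using DFunLike.congr_fun hs x
  refine ⟨n, fun i => {x | k i x ≠ 0}, s, fun i => (isClopen_support (k i)).isOpen, ?_, ?_, ?_⟩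
  · intro x hx
    by_contra hcon
    have h0 : ∀ i, k i x = 0 := by simpa using hcon
    have := DFunLike.congr_fun hk x
    simp [ContinuousMap.sum_apply, h0, clopenIndicator_of_mem hU hx] at this
    omega
  · intro i x hx
    rw [Set.mem_smul_set_iff_inv_smul_mem] at hx
    by_contra hxV
    have := hsum x
    rw [Set.indicator_of_notMem hxV, Finset.sum_eq_zero_iff] at this
    exact hx (this i (Finset.mem_univ i))
  · intro i j hij
    rw [Set.disjoint_left]
    intro x hi hj
    rw [Set.mem_smul_set_iff_inv_smul_mem] at hi hj
    have h1 : ∑ i, k i ((s i)⁻¹ • x) ≤ 1 := by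
      rw [hsum]
      exact Set.indicator_le_self' (fun _ _ => zero_le_one) x
    have h2 : ∑ l ∈ {i, j}, k l ((s l)⁻¹ • x) ≤ ∑ i, k i ((s i)⁻¹ • x) :=
      Finset.sum_le_sum_of_subset (Finset.subset_univ _)
    rw [Finset.sum_pair hij] at h2
    have hi' : k i ((s i)⁻¹ • x) ≠ 0 := hi
    have hj' : k j ((s j)⁻¹ • x) ≠ 0 := hj
    omega

end TypeSemigroupOrder

end CantorComparison

namespace CantorComparison

/-! ### Consequences of minimality for classes -/

section Semigroup

variable {G : Type*} [Group G] {X : Type*} [TopologicalSpace X] [MulAction G X]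
  [ContinuousConstSMul G X]

theorem TypeRel.nsmul {f g : C(X, ℕ)} (h : TypeRel G f g) (n : ℕ) :
    TypeRel G (n • f) (n • g) := by
  rw [← TypeSemigroup.mk_eq] at h ⊢
  rw [map_nsmul, map_nsmul, h]

theorem typeRel_translate (s : G) (f : C(X, ℕ)) : TypeRel G f (translate s f) :=
  ((TypeSemigroup.mk_eq G).1 (TypeSemigroup.mk_translate G s f)).symm

theorem exists_finset_smul_mem [CompactSpace X] [MulAction.IsMinimal G X] {U : Set X}
    (hU : IsOpen U) (hne : U.Nonempty) : ∃ I : Finset G, ∀ x, ∃ t ∈ I, t⁻¹ • x ∈ U := by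
  obtain ⟨I, hI⟩ := isCompact_univ.exists_finite_cover_smul G hU hne
  refine ⟨I, fun x => ?_⟩
  simpa [Set.mem_smul_set_iff_inv_smul_mem] using hI (Set.mem_univ x)

/-- By minimality every class is dominated by a multiple of the class of a nonempty clopen set. -/
theorem exists_mk_le_nsmul [CompactSpace X] [MulAction.IsMinimal G X] {U : Set X}
    (hU : IsClopen U) (hne : U.Nonempty) (f : C(X, ℕ)) :
    ∃ c : ℕ, TypeSemigroup.mk G f ≤ c • TypeSemigroup.mk G (clopenIndicator hU) := by
  obtain ⟨I, hI⟩ := exists_finset_smul_mem (G := G) hU.isOpen hne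
  obtain ⟨N, hN⟩ := exists_nat_bound f
  refine ⟨N * I.card, ?_⟩
  calc TypeSemigroup.mk G f
      ≤ TypeSemigroup.mk G (N • ∑ t ∈ I, translate t (clopenIndicator hU)) := by
        refine TypeSemigroup.mk_mono G fun x => ?_
        obtain ⟨t, ht, htx⟩ := hI x
        have h1 : 1 ≤ ∑ t ∈ I, clopenIndicator hU (t⁻¹ • x) := by
          rw [← clopenIndicator_of_mem hU htx]
          exact Finset.single_le_sum (f := fun t => clopenIndicator hU (t⁻¹ • x))
            (fun _ _ => Nat.zero_le _) ht
        have h2 := Nat.mul_le_mul (hN x) h1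
        simpa [ContinuousMap.sum_apply, translate_apply] using h2
    _ = (N * I.card) • TypeSemigroup.mk G (clopenIndicator hU) := by
        rw [map_nsmul, map_sum, Finset.sum_congr rfl fun t _ => TypeSemigroup.mk_translate G t _,
          Finset.sum_const, mul_nsmul']

end Semigroup

/-! ### The comparison cone and Hahn–Banach separation -/

section Cone

variable (G : Type*) [Group G] {X : Type*} [TopologicalSpace X] [MulAction G X]
  [ContinuousConstSMul G X]

/-- The real function underlying an element of `C(X, ℕ)`. -/
def realCast (f : C(X, ℕ)) : C(X, ℝ) := ⟨fun x => f x, by fun_prop⟩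

@[simp] theorem realCast_apply (f : C(X, ℕ)) (x : X) : realCast f x = f x := rfl

/-- The functions that are, up to arbitrarily small errors and rational scaling, dominated by
`f - g + L (1_V - a)` with `f ∼ g` and `V ⊆ B` clopen. -/
def comparisonCone (a : C(X, ℕ)) (B : Set X) : Set C(X, ℝ) :=
  {q | ∀ ε : ℝ, 0 < ε → ∃ N L : ℕ, 0 < N ∧ ∃ f g : C(X, ℕ), TypeRel G f g ∧
    ∃ (V : Set X) (hV : IsClopen V), V ⊆ B ∧ ∀ x,
      (N : ℝ) * (q x - ε) + g x + L * a x ≤ f x + L * (clopenIndicator hV x : ℝ)}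

variable {G} {a : C(X, ℕ)} {B : Set X}

theorem comparisonCone.mem_of_le {q : C(X, ℝ)} {f g : C(X, ℕ)} (h : TypeRel G f g)
    (hq : ∀ x, q x + g x ≤ f x) : q ∈ comparisonCone G a B := by
  refine fun ε hε => ⟨1, 0, one_pos, f, g, h, ∅, isClopen_empty, Set.empty_subset _, fun x => ?_⟩
  have := hq x
  simp only [Nat.cast_one, Nat.cast_zero]
  linarith

theorem comparisonCone.indicator_sub_mem {V : Set X} (hV : IsClopen V) (hVB : V ⊆ B) :
    realCast (clopenIndicator hV) - realCast a ∈ comparisonCone G a B := by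
  refine fun ε hε => ⟨1, 1, one_pos, 0, 0, TypeRel.refl 0, V, hV, hVB, fun x => ?_⟩
  simp
  linarith

/-- Cross-multiplication gives a common denominator, and both indicators are dominated by that of `V
∪ V'`, so one set still suffices as witness. -/
theorem comparisonCone.add_mem {q r : C(X, ℝ)} (hq : q ∈ comparisonCone G a B)
    (hr : r ∈ comparisonCone G a B) : q + r ∈ comparisonCone G a B := by
  intro ε hε
  obtain ⟨N, L, hN, f, g, hfg, V, hV, hVB, h⟩ := hq (ε / 2) (by positivity)
  obtain ⟨N', L', hN', f', g', hfg', V', hV', hVB', h'⟩ := hr (ε / 2) (by positivity)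
  refine ⟨N * N', N' * L + N * L', by positivity, N' • f + N • f', N' • g + N • g',
    (hfg.nsmul N').add (hfg'.nsmul N), V ∪ V', hV.union hV', Set.union_subset hVB hVB',
    fun x => ?_⟩
  have h1 : (clopenIndicator hV x : ℝ) ≤ clopenIndicator (hV.union hV') x := by
    exact_mod_cast Set.indicator_le_indicator_of_subset Set.subset_union_left
      (fun _ => Nat.zero_le 1) x
  have h2 : (clopenIndicator hV' x : ℝ) ≤ clopenIndicator (hV.union hV') x := by
    exact_mod_cast Set.indicator_le_indicator_of_subset Set.subset_union_right
      (fun _ => Nat.zero_le 1) x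
  have h3 := mul_le_mul_of_nonneg_left (h x) (Nat.cast_nonneg (α := ℝ) N')
  have h4 := mul_le_mul_of_nonneg_left (h' x) (Nat.cast_nonneg (α := ℝ) N)
  have h5 := mul_le_mul_of_nonneg_left h1 (Nat.cast_nonneg (α := ℝ) (N' * L))
  have h6 := mul_le_mul_of_nonneg_left h2 (Nat.cast_nonneg (α := ℝ) (N * L'))
  simp only [ContinuousMap.add_apply, ContinuousMap.nsmul_apply, smul_eq_mul]
  push_cast at *
  linarith

theorem comparisonCone.smul_mem [CompactSpace X] {q : C(X, ℝ)} (hq : q ∈ comparisonCone G a B)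
    {r : ℝ} (hr : 0 ≤ r) : r • q ∈ comparisonCone G a B := by
  intro ε hε
  obtain ⟨N, L, hN, f, g, hfg, V, hV, hVB, h⟩ := hq (ε / (2 * (r + 1))) (by positivity)
  -- The scalar `r` is replaced by `p / M`. The rounding error `r * M - p` is below 1 and costs at
  -- most `‖q‖`, which this `M` makes smaller than `M * ε / 2`.
  obtain ⟨M, hM⟩ := exists_nat_gt (2 * (‖q‖ + 1) / ε)
  have hM0 : (0 : ℝ) < M := lt_of_le_of_lt (by positivity) hM
  rw [div_lt_iff₀ hε] at hM
  set p : ℕ := ⌊r * M⌋₊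
  have hp : (p : ℝ) ≤ r * M := Nat.floor_le (by positivity)
  have hp' : r * M < p + 1 := Nat.lt_floor_add_one _
  refine ⟨N * M, p * L, by have : 0 < M := (by exact_mod_cast hM0); positivity, p • f, p • g,
    hfg.nsmul p, V, hV, hVB, fun x => ?_⟩
  have hqx : |q x| ≤ ‖q‖ := q.norm_coe_le_norm x
  have h1 : (r * M - p) * q x ≤ ‖q‖ := by
    calc (r * M - p) * q x ≤ |r * M - p| * |q x| := by
          rw [← abs_mul]; exact le_abs_self _
      _ ≤ 1 * ‖q‖ := by
          gcongr
          rw [abs_le]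
          constructor <;> linarith
      _ = ‖q‖ := one_mul _
  have h2 : (p : ℝ) * (ε / (2 * (r + 1))) ≤ M * ε / 2 := by
    calc (p : ℝ) * (ε / (2 * (r + 1))) ≤ ((r + 1) * M) * (ε / (2 * (r + 1))) := by
          gcongr
          linarith
      _ = M * ε / 2 := by field_simp
  have h3 : (M : ℝ) * (r * q x - ε) ≤ p * (q x - ε / (2 * (r + 1))) := by
    nlinarith
  have h4 := mul_le_mul_of_nonneg_left h3 (Nat.cast_nonneg (α := ℝ) N)
  have h5 := mul_le_mul_of_nonneg_left (h x) (Nat.cast_nonneg (α := ℝ) p)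
  simp only [ContinuousMap.smul_apply, smul_eq_mul]
  push_cast
  linarith

theorem comparisonCone.isClosed [CompactSpace X] : IsClosed (comparisonCone G a B) := by
  refine isClosed_of_closure_subset fun q hq ε hε => ?_
  obtain ⟨r, hr, hqr⟩ := Metric.mem_closure_iff.1 hq (ε / 2) (by positivity)
  obtain ⟨N, L, hN, f, g, hfg, V, hV, hVB, h⟩ := hr (ε / 2) (by positivity)
  refine ⟨N, L, hN, f, g, hfg, V, hV, hVB, fun x => le_trans ?_ (h x)⟩
  have h1 := (ContinuousMap.dist_apply_le_dist (f := q) (g := r) x).trans hqr.le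
  rw [Real.dist_eq, abs_le] at h1
  gcongr ?_ * ?_ + _ + _
  linarith [h1.2]

/-- A functional separating the constant function `1` from the cone. -/
theorem comparisonCone.exists_functional [CompactSpace X] (h1 : (1 : C(X, ℝ)) ∉ comparisonCone G a B) :
    ∃ φ : C(X, ℝ) →ₗ[ℝ] ℝ, φ 1 = 1 ∧ ∀ q ∈ comparisonCone G a B, φ q ≤ 0 := by
  have hconv : Convex ℝ (comparisonCone G a B) := fun q hq r hr s t hs ht _ =>
    add_mem (smul_mem hq hs) (smul_mem hr ht)
  obtain ⟨φ, u, hφ, hu⟩ := geometric_hahn_banach_closed_point hconv isClosed h1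
  have h0 : (0 : C(X, ℝ)) ∈ comparisonCone G a B := mem_of_le (TypeRel.refl 0) (by simp)
  have hu0 : 0 < u := by simpa using hφ 0 h0
  -- A positive value of `φ` on the cone could be scaled to equal `u`, which is a strict bound
  -- there.
  have hneg : ∀ q ∈ comparisonCone G a B, φ q ≤ 0 := by
    intro q hq
    by_contra! hpos
    have := hφ _ (smul_mem hq (div_pos hu0 hpos).le)
    simp [hpos.ne'] at this
  have hφ1 : 0 < φ 1 := hu0.trans hu
  refine ⟨(φ 1)⁻¹ • (φ : C(X, ℝ) →ₗ[ℝ] ℝ), by simp [hφ1.ne'], fun q hq => ?_⟩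
  simpa using mul_nonpos_of_nonneg_of_nonpos (inv_nonneg.2 hφ1.le) (hneg q hq)

end Cone

theorem exists_clopen_measure_lt {X : Type*} [TopologicalSpace X] [T2Space X]
    [CompactSpace X] [TotallyDisconnectedSpace X] [MeasurableSpace X] {μ : Measure X} [μ.Regular] {B : Set X} (hB : IsOpen B)
    {r : ENNReal} (hr : r < μ B) : ∃ V, IsClopen V ∧ V ⊆ B ∧ r < μ V := by
  obtain ⟨K, hKB, hK, hrK⟩ := hB.exists_lt_isCompact hr
  obtain ⟨V, hV, hKV, hVB⟩ := exists_clopen_of_closed_subset_open hK.isClosed hB hKB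
  exact ⟨V, hV, hVB, hrK.trans_le (measure_mono hKV)⟩

/-! ### Invariant measures, and comparison from almost unperforation -/

section Measure

variable {G : Type*} [Group G] {X : Type*} [TopologicalSpace X] [T2Space X] [CompactSpace X]
  [SecondCountableTopology X] [TotallyDisconnectedSpace X] [MeasurableSpace X] [BorelSpace X]
  [MulAction G X] [ContinuousConstSMul G X]

/-- A finite Borel measure on a zero-dimensional space is invariant if it is so on clopen sets. -/
theorem smulInvariantMeasure_of_isClopen {μ : Measure X} [IsFiniteMeasure μ]
    (h : ∀ (s : G) (U : Set X), IsClopen U → μ ((fun x => s • x) ⁻¹' U) = μ U) :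
    SMulInvariantMeasure G X μ := by
  refine ⟨fun s E hE => ?_⟩
  have hs : Measurable fun x : X => s • x := (continuous_const_smul s).measurable
  have key : μ.map (fun x => s • x) = μ := by
    refine ext_of_generate_finite {U : Set X | IsClopen U} ?_ ?_ ?_ ?_
    · rw [BorelSpace.measurable_eq (α := X)]
      exact (loc_compact_Haus_tot_disc_of_zero_dim (H := X)).borel_eq_generateFrom
    · exact fun U hU V hV _ => hU.inter hV
    · intro U hU
      rw [Measure.map_apply hs hU.isOpen.measurableSet, h s U hU]
    · rw [Measure.map_apply hs MeasurableSet.univ, Set.preimage_univ]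
  conv_rhs => rw [← key, Measure.map_apply hs hE]

/-- A positive normalized functional that is constant on `∼` comes from an invariant measure. -/
theorem exists_invariantMeasure_of_functional (φ : C(X, ℝ) →ₗ[ℝ] ℝ) (h1 : φ 1 = 1)
    (hpos : ∀ q : C(X, ℝ), (∀ x, 0 ≤ q x) → 0 ≤ φ q)
    (hinv : ∀ f g : C(X, ℕ), TypeRel G f g → φ (realCast f) = φ (realCast g)) :
    ∃ μ ∈ invariantMeasures G X, ∀ (U : Set X) (hU : IsClopen U),
      μ U = ENNReal.ofReal (φ (realCast (clopenIndicator hU))) := by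
  let Λ : CompactlySupportedContinuousMap X ℝ →ₚ[ℝ] ℝ :=
    { toFun g := φ g.toContinuousMap
      map_add' g g' := map_add φ g.toContinuousMap g'.toContinuousMap
      map_smul' c g := map_smul φ c g.toContinuousMap
      monotone' g g' hgg' := by
        have := hpos (g'.toContinuousMap - g.toContinuousMap) fun x => sub_nonneg.2 (hgg' x)
        rw [map_sub] at this
        exact sub_nonneg.1 this }
  set μ := RealRMK.rieszMeasure Λ
  have hμ : ∀ (U : Set X) (hU : IsClopen U),
      μ U = ENNReal.ofReal (φ (realCast (clopenIndicator hU))) := by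
    intro U hU
    have h2 := RealRMK.integral_rieszMeasure Λ
      ⟨realCast (clopenIndicator hU), HasCompactSupport.of_compactSpace _⟩
    have h3 : ∀ x, (realCast (clopenIndicator hU)) x = U.indicator (1 : X → ℝ) x := by
      intro x
      by_cases hx : x ∈ U <;> simp [clopenIndicator_apply, hx]
    have h4 : ∫ x, (realCast (clopenIndicator hU)) x ∂μ = μ.real U := by
      simp_rw [h3]
      exact integral_indicator_one hU.isOpen.measurableSet
    rw [← ofReal_measureReal (measure_ne_top μ U), ← h4]
    exact congrArg ENNReal.ofReal h2
  refine ⟨μ, ⟨⟨?_⟩, inferInstance, smulInvariantMeasure_of_isClopen fun s U hU => ?_⟩, hμ⟩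
  · rw [hμ _ isClopen_univ]
    have : realCast (clopenIndicator (isClopen_univ (X := X))) = 1 := by
      ext x
      simp [clopenIndicator_apply]
    simp [this, h1]
  · rw [hμ _ hU, hμ _ (hU.preimage (continuous_const_smul s))]
    congr 1
    have : translate s (clopenIndicator (hU.preimage (continuous_const_smul s))) =
        clopenIndicator hU := by
      ext x
      have hmem : s⁻¹ • x ∈ (fun x => s • x) ⁻¹' U ↔ x ∈ U := by
        rw [Set.mem_preimage, smul_inv_smul]
      rw [translate_apply]
      by_cases hx : x ∈ U
      · rw [clopenIndicator_of_mem _ (hmem.2 hx), clopenIndicator_of_mem _ hx]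
      · rw [clopenIndicator_of_notMem _ (mt hmem.1 hx), clopenIndicator_of_notMem _ hx]
    refine hinv _ _ ?_
    rw [← this]
    exact typeRel_translate s _

/-- If every invariant measure is smaller on the clopen set `A` than on the open set `B`, then the
constant function `1` lies in the comparison cone. -/
theorem one_mem_comparisonCone {A B : Set X} (hA : IsClopen A) (hB : IsOpen B)
    (h : ∀ μ ∈ invariantMeasures G X, μ A < μ B) :
    (1 : C(X, ℝ)) ∈ comparisonCone G (clopenIndicator hA) B := by
  by_contra hcon
  obtain ⟨φ, hφ1, hφ⟩ := comparisonCone.exists_functional hcon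
  -- The cone contains every nonpositive function, so `φ` is positive; it contains both `f - g` and
  -- `g - f` when `f ∼ g`, so `φ` is constant on classes.
  obtain ⟨μ, hμ, hμφ⟩ := exists_invariantMeasure_of_functional (G := G) φ hφ1
    (fun q hq => by
      have := hφ (-q) (comparisonCone.mem_of_le (TypeRel.refl 0) fun x => by simpa using hq x)
      simpa using this)
    (fun f g hfg => by
      have h1 := hφ (realCast f - realCast g) (comparisonCone.mem_of_le hfg fun x => by simp)
      have h2 := hφ (realCast g - realCast f) (comparisonCone.mem_of_le hfg.symm fun x => by simp)
      rw [map_sub] at h1 h2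
      linarith)
  have := hμ.2.1
  obtain ⟨V, hV, hVB, hlt⟩ := exists_clopen_measure_lt hB (h μ hμ)
  have h1 := hφ _ (comparisonCone.indicator_sub_mem hV hVB)
  rw [map_sub, sub_nonpos] at h1
  rw [hμφ _ hA, hμφ _ hV] at hlt
  exact hlt.not_ge (ENNReal.ofReal_le_ofReal h1)

theorem AlmostUnperforated.hasComparison [MulAction.IsMinimal G X]
    (hS : AlmostUnperforated (TypeSemigroup G X)) : HasComparison G X := by
  intro A B hA hB _ hB' hμ C hC hCA
  obtain ⟨A', hA', hCA', hAA'⟩ := exists_clopen_of_closed_subset_open hC hA hCA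
  -- The error `1 / 2` leaves a surplus `N / 2 ≥ 1 / 2`; doubling everything turns it into the
  -- constant function 1, an order unit above `1_{A'}`.
  obtain ⟨N, L, hN, f, g, hfg, V, hV, hVB, h⟩ := one_mem_comparisonCone (G := G) hA' hB
    (fun μ hμ' => (measure_mono hAA').trans_lt (hμ μ hμ')) (1 / 2) (by norm_num)
  obtain ⟨b, hb⟩ := hB'
  obtain ⟨V₀, hV₀, hbV, hV₀B⟩ := compact_exists_isClopen_in_isOpen hB hb
  have hW : IsClopen (V ∪ V₀) := hV.union hV₀
  obtain ⟨c, hc⟩ := exists_mk_le_nsmul (G := G) hW ⟨b, Or.inr hbV⟩ (2 • f)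
  have hfg' : TypeSemigroup.mk G (2 • f) = TypeSemigroup.mk G (2 • g) :=
    (TypeSemigroup.mk_eq G).2 (hfg.nsmul 2)
  have hle : TypeSemigroup.mk G (2 • g + ((2 * L) • clopenIndicator hA' + 1)) ≤
      TypeSemigroup.mk G (2 • f + (2 * L) • clopenIndicator hW) := by
    refine TypeSemigroup.mk_mono G fun x => ?_
    have h1 : (clopenIndicator hV x : ℝ) ≤ clopenIndicator hW x := by
      exact_mod_cast Set.indicator_le_indicator_of_subset Set.subset_union_left
        (fun _ => Nat.zero_le 1) x
    have h2 := mul_le_mul_of_nonneg_left h1 (Nat.cast_nonneg (α := ℝ) L)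
    have h3 := h x
    have h4 : (1 : ℝ) ≤ N := by exact_mod_cast hN
    simp only [ContinuousMap.one_apply] at h3
    have h5 : (2 * g x + (2 * L * clopenIndicator hA' x + 1) : ℝ) ≤
        2 * f x + 2 * L * clopenIndicator hW x := by linarith
    simp only [ContinuousMap.add_apply, ContinuousMap.nsmul_apply, smul_eq_mul,
      ContinuousMap.one_apply]
    exact_mod_cast h5
  rw [map_add, map_add, map_add, ← hfg', map_nsmul, map_nsmul _ (2 * L) (clopenIndicator hW)] at hle
  have hau : TypeSemigroup.mk G (clopenIndicator hA') ≤ TypeSemigroup.mk G 1 :=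
    TypeSemigroup.mk_mono G fun x => Set.indicator_le_self' (fun _ _ => zero_le_one) x
  obtain ⟨n, W, s, hWo, hAW, hWV, hd⟩ :=
    TypeRel.exists_disjoint_family hA' hW (hS.le_of_add_le hle hau hc)
  exact Subequiv.of_family W s (fun _ => 0) hWo hAW
    (fun i => (hWV i).trans (Set.union_subset hVB hV₀B)) (fun i j hij _ => hd i j hij) C hC hCA'

end Measure

end CantorComparison

namespace CantorComparison

/-! ### Sums along invariant shapes -/

section Shapes

open scoped Classical in
theorem sum_le_sum_add_card_sdiff {G : Type*} (P Q : Finset G) {M : ℕ} (h : G → ℕ)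
    (hM : ∀ s, h s ≤ M) : ∑ s ∈ P, h s ≤ ∑ s ∈ Q, h s + M * (P \ Q).card := by
  calc ∑ s ∈ P, h s ≤ ∑ s ∈ Q ∪ P \ Q, h s :=
        Finset.sum_le_sum_of_subset fun s hs => by by_cases s ∈ Q <;> simp_all
    _ = ∑ s ∈ Q, h s + ∑ s ∈ P \ Q, h s := Finset.sum_union Finset.disjoint_sdiff
    _ ≤ ∑ s ∈ Q, h s + M * (P \ Q).card := by
        gcongr
        rw [mul_comm, ← smul_eq_mul]
        exact Finset.sum_le_card_nsmul _ _ _ fun s _ => hM s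

variable {G : Type*} [Group G]

open scoped Classical in
theorem IsInvariantShape.card_smul_sdiff_le {K : Finset G} {δ : ℝ} {F : Finset G}
    (h : IsInvariantShape K δ F) {t : G} (ht : t ∈ K) : ((t • F \ F).card : ℝ) ≤ δ * F.card :=
  le_trans (by exact_mod_cast Finset.card_le_card (by rw [symmDiff_def]; exact le_sup_left)) (h t ht)

open scoped Classical in
theorem IsInvariantShape.card_sdiff_smul_le {K : Finset G} {δ : ℝ} {F : Finset G}
    (h : IsInvariantShape K δ F) {t : G} (ht : t ∈ K) : ((F \ t • F).card : ℝ) ≤ δ * F.card :=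
  le_trans (by exact_mod_cast Finset.card_le_card (by rw [symmDiff_def]; exact le_sup_right)) (h t ht)

open scoped Classical in
theorem sum_smul_finset (t : G) (S : Finset G) (h : G → ℕ) :
    ∑ s ∈ t • S, h s = ∑ s ∈ S, h (t * s) := by
  rw [← Finset.image_smul, Finset.sum_image fun a _ b _ hab => by simpa using hab]
  rfl

variable {K : Finset G} {δ : ℝ} {S : Finset G} {t : G} {M : ℕ}

/-- Shifting the argument by `t` replaces `S` by `t • S`; at most `δ * S.card` terms are lost, each
at most `M`. -/
theorem IsInvariantShape.sum_le_sum_mul (hS : IsInvariantShape K δ S) (ht : t ∈ K) (h : G → ℕ)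
    (hM : ∀ s, h s ≤ M) :
    ((∑ s ∈ S, h s : ℕ) : ℝ) ≤ (∑ s ∈ S, h (t * s) : ℕ) + M * (δ * S.card) := by
  classical
  rw [← sum_smul_finset]
  refine le_trans (Nat.cast_le.2 (sum_le_sum_add_card_sdiff S (t • S) h hM)) ?_
  push_cast
  gcongr
  exact hS.card_sdiff_smul_le ht

theorem IsInvariantShape.sum_mul_le_sum (hS : IsInvariantShape K δ S) (ht : t ∈ K) (h : G → ℕ)
    (hM : ∀ s, h s ≤ M) :
    ((∑ s ∈ S, h (t * s) : ℕ) : ℝ) ≤ (∑ s ∈ S, h s : ℕ) + M * (δ * S.card) := by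
  classical
  rw [← sum_smul_finset]
  refine le_trans (Nat.cast_le.2 (sum_le_sum_add_card_sdiff (t • S) S h hM)) ?_
  push_cast
  gcongr
  exact hS.card_smul_sdiff_le ht

end Shapes

/-! ### Castles and their levels -/

section Castles

variable {G : Type*} [Group G] {X : Type*} [MulAction G X]

theorem mem_towerUnion {S : Finset G} {V : Set X} {x : X} :
    x ∈ towerUnion S V ↔ ∃ s ∈ S, x ∈ s • V := by simp [towerUnion]

theorem towerUnion_mono {S T : Finset G} {V W : Set X} (hS : S ⊆ T) (hV : V ⊆ W) :
    towerUnion S V ⊆ towerUnion T W :=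
  Set.biUnion_mono hS fun _ _ => Set.smul_set_mono hV

theorem IsCastle.eq_of_mem {k : ℕ} {V : Fin k → Set X} {S : Fin k → Finset G} (h : IsCastle V S)
    {i j : Fin k} {s t : G} (hs : s ∈ S i) (ht : t ∈ S j) {x : X} (hxs : x ∈ s • V i)
    (hxt : x ∈ t • V j) : i = j ∧ s = t := by
  have hij : i = j := by
    by_contra hne
    exact Set.disjoint_left.1 (h.2 i j hne) (mem_towerUnion.2 ⟨s, hs, hxs⟩)
      (mem_towerUnion.2 ⟨t, ht, hxt⟩)
  subst hij
  refine ⟨rfl, ?_⟩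
  by_contra hne
  exact Set.disjoint_left.1 (h.1 i s hs t ht hne) hxs hxt

theorem IsCastle.mono {k : ℕ} {V W : Fin k → Set X} {S : Fin k → Finset G} (h : IsCastle V S)
    (hWV : ∀ i, W i ⊆ V i) : IsCastle W S :=
  ⟨fun i s hs t ht hst => (h.1 i s hs t ht hst).mono (Set.smul_set_mono (hWV i))
      (Set.smul_set_mono (hWV i)),
    fun i j hij => (h.2 i j hij).mono (towerUnion_mono subset_rfl (hWV i))
      (towerUnion_mono subset_rfl (hWV j))⟩

variable [TopologicalSpace X] [ContinuousConstSMul G X]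

theorem isOpen_towerUnion (S : Finset G) {V : Set X} (hV : IsOpen V) : IsOpen (towerUnion S V) :=
  isOpen_biUnion fun s _ => hV.smul s

theorem isClopen_smul {V : Set X} (hV : IsClopen V) (s : G) : IsClopen (s • V) :=
  ⟨hV.1.smul s, hV.2.smul s⟩

theorem isClopen_towerUnion (S : Finset G) {V : Set X} (hV : IsClopen V) :
    IsClopen (towerUnion S V) :=
  S.finite_toSet.isClopen_biUnion fun s _ => isClopen_smul hV s

theorem translate_clopenIndicator {V : Set X} (hV : IsClopen V) (s : G) :
    translate s (clopenIndicator hV) = clopenIndicator (isClopen_smul hV s) := by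
  ext x
  rw [translate_apply]
  by_cases hx : s⁻¹ • x ∈ V
  · rw [clopenIndicator_of_mem _ hx,
      clopenIndicator_of_mem _ (Set.mem_smul_set_iff_inv_smul_mem.2 hx)]
  · rw [clopenIndicator_of_notMem _ hx,
      clopenIndicator_of_notMem _ (mt Set.mem_smul_set_iff_inv_smul_mem.1 hx)]

/-- A closed subset of an open castle meets every level in a closed set. -/
theorem IsCastle.isClosed_inter_level {k : ℕ} {V : Fin k → Set X} {S : Fin k → Finset G}
    (h : IsCastle V S) (hV : ∀ i, IsOpen (V i)) {H : Set X} (hH : IsClosed H)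
    (hHV : H ⊆ ⋃ i, towerUnion (S i) (V i)) {i : Fin k} {s : G} (hs : s ∈ S i) :
    IsClosed (H ∩ s • V i) := by
  -- The levels are disjoint and cover `H`, so the trace on one level is what remains after removing
  -- the other, open, levels.
  have : H ∩ s • V i = H ∩ (⋃ (j : Fin k) (t : G) (_ : t ∈ S j ∧ ¬ (i = j ∧ s = t)), t • V j)ᶜ := by
    ext x
    refine and_congr_right fun hx => ⟨fun hxs hx' => ?_, fun hx' => ?_⟩
    · simp only [Set.mem_iUnion] at hx'
      obtain ⟨j, t, ⟨ht, hne⟩, hxt⟩ := hx'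
      exact hne (h.eq_of_mem hs ht hxs hxt)
    · obtain ⟨j, hj⟩ := Set.mem_iUnion.1 (hHV hx)
      obtain ⟨t, ht, hxt⟩ := mem_towerUnion.1 hj
      by_cases hc : i = j ∧ s = t
      · obtain ⟨rfl, rfl⟩ := hc
        exact hxt
      · refine absurd ?_ hx'
        simp only [Set.mem_iUnion]
        exact ⟨j, t, ⟨ht, hc⟩, hxt⟩
  rw [this]
  exact hH.inter (isOpen_iUnion fun j => isOpen_iUnion fun t => isOpen_iUnion fun _ =>
    (hV j).smul t).isClosed_compl

end Castles

/-! ### Making almost finite castles clopen -/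

section ClopenCastles

variable {G : Type*} [Group G] {X : Type*} [MulAction G X]

theorem exists_clopen_shrinking [TopologicalSpace X] [CompactSpace X] [T2Space X]
    [TotallyDisconnectedSpace X] {ι : Type*} [Finite ι] {Z : Set X} (hZ : IsClosed Z)
    {U : ι → Set X} (hU : ∀ i, IsOpen (U i)) (hZU : Z ⊆ ⋃ i, U i) :
    ∃ C : ι → Set X, (∀ i, IsClopen (C i)) ∧ (∀ i, C i ⊆ U i) ∧ Z ⊆ ⋃ i, C i := by
  obtain ⟨v, hZv, hv, hvU⟩ := exists_subset_iUnion_closed_subset hZ hU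
    (fun x _ => Set.toFinite _) hZU
  choose C hC hvC hCU using fun i => exists_clopen_of_closed_subset_open (hv i) (hU i) (hvU i)
  exact ⟨C, hC, hCU, hZv.trans (Set.iUnion_mono hvC)⟩

variable [MetricSpace X] [CompactSpace X] [TotallyDisconnectedSpace X] [ContinuousConstSMul G X]

/-- In an almost finite action on a zero-dimensional space the castles can be chosen clopen. -/
theorem AlmostFinite.exists_clopen_castle (h : AlmostFinite G X) (n : ℕ) (K : Finset G) {δ : ℝ}
    (hn : 0 < n) (hδ : 0 < δ) :
    ∃ (k : ℕ) (W : Fin k → Set X) (S S' : Fin k → Finset G) (hW : ∀ i, IsClopen (W i))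
      (R : Set X) (hR : IsClopen R), IsCastle W S ∧ (∀ i, IsInvariantShape K δ (S i)) ∧
      (∀ i, ((S' i).card : ℝ) < (S i).card / n) ∧ Rᶜ = ⋃ i, towerUnion (S i) (W i) ∧
      TypeSemigroup.mk G (clopenIndicator hR) ≤
        TypeSemigroup.mk G (∑ i, (S' i).card • clopenIndicator (hW i)) := by
  classical
  obtain ⟨k, V, S, hcastle, hV, hS, -, S', hS'S, hS'card, hsub⟩ := h n K δ hn hδ
  have hopen : IsOpen (⋃ i, towerUnion (S i) (V i)) :=
    isOpen_iUnion fun i => isOpen_towerUnion (S i) (hV i)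
  obtain ⟨𝒰, hfin, h𝒰, hcov, s, c, hs, hd⟩ := hsub _ hopen.isClosed_compl subset_rfl
  have : Fintype 𝒰 := hfin.fintype
  obtain ⟨C, hC, hCU, hcovC⟩ := exists_clopen_shrinking (ι := 𝒰) (U := Subtype.val)
    hopen.isClosed_compl (fun u => h𝒰 u u.2) (by rwa [← Set.sUnion_eq_iUnion])
  have hCc : IsClopen (⋃ u, C u) := isClopen_iUnion_of_finite hC
  have hE : IsClopen (⋃ u : 𝒰, s u • C u) :=
    isClopen_iUnion_of_finite fun u => isClopen_smul (hC u) _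
  have hEV : (⋃ u : 𝒰, s u • C u) ⊆ ⋃ i, towerUnion (S' i) (V i) :=
    Set.iUnion_subset fun u => (Set.smul_set_mono (hCU u)).trans (hs u u.2)
  -- `H` is what the clopen castle must keep: the points not covered by the `C u`, so that the new
  -- remainder stays inside the cover, and the images of the `C u`, so that they still land in
  -- selected levels. It is a closed part of the open castle; its traces on the levels, pulled back
  -- to the bases, are closed, hence contained in clopen sets `W i ⊆ V i`.
  set H := (⋃ u, C u)ᶜ ∪ ⋃ u : 𝒰, s u • C u with hHdef
  have hH : IsClosed H := hCc.compl.isClosed.union hE.isClosed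
  have hHV : H ⊆ ⋃ i, towerUnion (S i) (V i) :=
    Set.union_subset (Set.compl_subset_comm.1 hcovC)
      (hEV.trans (Set.iUnion_mono fun i => towerUnion_mono (hS'S i) subset_rfl))
  have hZ : ∀ i, IsClosed (⋃ t ∈ S i, t⁻¹ • (H ∩ t • V i)) := fun i =>
    (S i).finite_toSet.isClosed_biUnion fun t ht =>
      (hcastle.isClosed_inter_level hV hH hHV ht).smul _
  have hZV : ∀ i, (⋃ t ∈ S i, t⁻¹ • (H ∩ t • V i)) ⊆ V i := by
    refine fun i => Set.iUnion₂_subset fun t _ => ?_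
    rw [Set.smul_set_subset_iff_subset_inv_smul_set, inv_inv]
    exact Set.inter_subset_right
  choose W hW hZW hWV using fun i => exists_clopen_of_closed_subset_open (hZ i) (hV i) (hZV i)
  have hmem : ∀ {i t x}, t ∈ S i → x ∈ H → x ∈ t • V i → x ∈ t • W i := by
    intro i t x ht hx hxt
    rw [Set.mem_smul_set_iff_inv_smul_mem]
    exact hZW i (Set.mem_biUnion ht (Set.smul_mem_smul_set ⟨hx, hxt⟩))
  have htower : IsClopen (⋃ i, towerUnion (S i) (W i)) :=
    isClopen_iUnion_of_finite fun i => isClopen_towerUnion (S i) (hW i)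
  refine ⟨k, W, S, S', hW, _, htower.compl, hcastle.mono hWV, hS, hS'card, compl_compl _, ?_⟩
  have hlevel : ∀ x, x ∈ (⋃ u : 𝒰, s u • C u) → ∃ i, ∃ t ∈ S' i, x ∈ t • W i := by
    intro x hx
    obtain ⟨i, hi⟩ := Set.mem_iUnion.1 (hEV hx)
    obtain ⟨t, ht, hxt⟩ := mem_towerUnion.1 hi
    exact ⟨i, t, ht, hmem (hS'S i ht) (Or.inr hx) hxt⟩
  calc TypeSemigroup.mk G (clopenIndicator htower.compl)
      ≤ TypeSemigroup.mk G (∑ u, clopenIndicator (hC u)) := by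
        refine TypeSemigroup.mk_mono G fun x => ?_
        by_cases hx : x ∈ (⋃ i, towerUnion (S i) (W i))ᶜ
        · have hxC : x ∈ ⋃ u, C u := by
            by_contra hxC
            obtain ⟨i, hi⟩ := Set.mem_iUnion.1 (hHV (Or.inl hxC))
            obtain ⟨t, ht, hxt⟩ := mem_towerUnion.1 hi
            exact hx (Set.mem_iUnion.2 ⟨i, mem_towerUnion.2 ⟨t, ht, hmem ht (Or.inl hxC) hxt⟩⟩)
          obtain ⟨u, hu⟩ := Set.mem_iUnion.1 hxC
          rw [clopenIndicator_of_mem _ hx, ContinuousMap.sum_apply,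
            ← clopenIndicator_of_mem (hC u) hu]
          exact Finset.single_le_sum (f := fun u => clopenIndicator (hC u) x)
            (fun _ _ => Nat.zero_le _) (Finset.mem_univ u)
        · rw [clopenIndicator_of_notMem _ hx]
          exact Nat.zero_le _
    _ = TypeSemigroup.mk G (∑ u : 𝒰, translate (s u) (clopenIndicator (hC u))) := by
        simp only [map_sum, TypeSemigroup.mk_translate]
    _ ≤ TypeSemigroup.mk G (∑ i, ∑ t ∈ S' i, translate t (clopenIndicator (hW i))) := by
        refine TypeSemigroup.mk_mono G fun x => ?_
        simp only [ContinuousMap.sum_apply, translate_clopenIndicator]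
        by_cases hx : x ∈ ⋃ u : 𝒰, s u • C u
        · obtain ⟨u, hu⟩ := Set.mem_iUnion.1 hx
          obtain ⟨i, t, ht, hxt⟩ := hlevel x hx
          rw [Finset.sum_eq_single u, clopenIndicator_of_mem _ hu]
          · rw [← clopenIndicator_of_mem (isClopen_smul (hW i) t) hxt]
            refine le_trans ?_ (Finset.single_le_sum (f := fun i => ∑ t ∈ S' i,
              clopenIndicator (isClopen_smul (hW i) t) x) (fun _ _ => Nat.zero_le _)
              (Finset.mem_univ i))
            exact Finset.single_le_sum
              (f := fun t => clopenIndicator (isClopen_smul (hW i) t) x)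
              (fun _ _ => Nat.zero_le _) ht
          · intro v _ hvu
            refine clopenIndicator_of_notMem _ fun hv => ?_
            refine Set.disjoint_left.1 (hd v v.2 u u.2 (fun h => hvu (Subtype.ext h))
              (Fin.ext (by omega))) (Set.smul_set_mono (hCU v) hv) (Set.smul_set_mono (hCU u) hu)
          · simp
        · rw [Finset.sum_eq_zero]
          · exact Nat.zero_le _
          · exact fun u _ => clopenIndicator_of_notMem _ fun hu => hx (Set.mem_iUnion.2 ⟨u, hu⟩)
    _ = TypeSemigroup.mk G (∑ i, (S' i).card • clopenIndicator (hW i)) := by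
        simp only [map_sum, TypeSemigroup.mk_translate, Finset.sum_const, map_nsmul]

end ClopenCastles

/-! ### Collapsing functions onto the bases of a castle -/

section Unperforation

variable {G : Type*} [Group G] {X : Type*} [TopologicalSpace X] [MulAction G X]
  [ContinuousConstSMul G X] {k : ℕ} {W : Fin k → Set X} (S : Fin k → Finset G)
  (hW : ∀ i, IsClopen (W i))

/-- The function on the bases of a castle obtained by summing `f` along the towers. -/
noncomputable def towerSum (f : C(X, ℕ)) : C(X, ℕ) :=
  ∑ i, ∑ s ∈ S i, translate s⁻¹ f * clopenIndicator (hW i)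

theorem towerSum_apply (f : C(X, ℕ)) (x : X) :
    towerSum S hW f x = ∑ i, (∑ s ∈ S i, f (s • x)) * clopenIndicator (hW i) x := by
  simp [towerSum, ContinuousMap.sum_apply, translate_apply, Finset.sum_mul]

/-- Translation by `s` moves each summand from the base to level `s`, so up to equivalence
collapsing only cuts `f` down to the levels. -/
theorem mk_towerSum (f : C(X, ℕ)) : TypeSemigroup.mk G (towerSum S hW f) =
    TypeSemigroup.mk G (∑ i, ∑ s ∈ S i, f * clopenIndicator (isClopen_smul (hW i) s)) := by
  simp only [towerSum, map_sum]
  refine Finset.sum_congr rfl fun i _ => Finset.sum_congr rfl fun s _ => ?_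
  rw [← TypeSemigroup.mk_translate G s, ← translate_clopenIndicator (hW i)]
  congr 1
  ext x
  simp [translate_apply]

variable {S}

theorem IsCastle.mk_towerSum_le (h : IsCastle W S) (f : C(X, ℕ)) :
    TypeSemigroup.mk G (towerSum S hW f) ≤ TypeSemigroup.mk G f := by
  rw [mk_towerSum]
  refine TypeSemigroup.mk_mono G fun x => ?_
  simp only [ContinuousMap.sum_apply, ContinuousMap.mul_apply]
  by_cases hx : ∃ i, ∃ s ∈ S i, x ∈ s • W i
  · obtain ⟨i, s, hs, hxs⟩ := hx
    rw [Finset.sum_eq_single i, Finset.sum_eq_single s]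
    · rw [clopenIndicator_of_mem _ hxs, mul_one]
    · intro t ht hts
      rw [clopenIndicator_of_notMem, mul_zero]
      exact fun hxt => hts (h.eq_of_mem ht hs hxt hxs).2
    · exact fun hs' => absurd hs hs'
    · intro j _ hji
      refine Finset.sum_eq_zero fun t ht => ?_
      rw [clopenIndicator_of_notMem, mul_zero]
      exact fun hxt => hji (h.eq_of_mem ht hs hxt hxs).1
    · simp
  · rw [Finset.sum_eq_zero]
    · exact Nat.zero_le _
    · refine fun i _ => Finset.sum_eq_zero fun t ht => ?_
      rw [clopenIndicator_of_notMem, mul_zero]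
      exact fun hxt => hx ⟨i, t, ht, hxt⟩

theorem le_mk_towerSum_add {R : Set X} (hR : IsClopen R)
    (hRW : Rᶜ = ⋃ i, towerUnion (S i) (W i)) (f : C(X, ℕ)) {M : ℕ} (hM : ∀ x, f x ≤ M) :
    TypeSemigroup.mk G f ≤
      TypeSemigroup.mk G (towerSum S hW f) + M • TypeSemigroup.mk G (clopenIndicator hR) := by
  rw [mk_towerSum, ← map_nsmul, ← map_add]
  refine TypeSemigroup.mk_mono G fun x => ?_
  simp only [ContinuousMap.add_apply, ContinuousMap.sum_apply, ContinuousMap.mul_apply,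
    ContinuousMap.nsmul_apply, smul_eq_mul]
  by_cases hx : x ∈ R
  · rw [clopenIndicator_of_mem _ hx, mul_one]
    exact (hM x).trans (Nat.le_add_left _ _)
  · have hx' : x ∈ Rᶜ := hx
    rw [hRW] at hx'
    obtain ⟨i, hi⟩ := Set.mem_iUnion.1 hx'
    obtain ⟨s, hs, hxs⟩ := mem_towerUnion.1 hi
    refine le_trans ?_ (Nat.le_add_right _ _)
    calc f x = f x * clopenIndicator (isClopen_smul (hW i) s) x := by
          rw [clopenIndicator_of_mem _ hxs, mul_one]
      _ ≤ ∑ s ∈ S i, f x * clopenIndicator (isClopen_smul (hW i) s) x :=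
          Finset.single_le_sum (f := fun s => f x * clopenIndicator (isClopen_smul (hW i) s) x)
            (fun _ _ => Nat.zero_le _) hs
      _ ≤ _ := Finset.single_le_sum
            (f := fun i => ∑ s ∈ S i, f x * clopenIndicator (isClopen_smul (hW i) s) x)
            (fun _ _ => Nat.zero_le _) (Finset.mem_univ i)

end Unperforation

/-! ### Order relations and minimality seen along invariant shapes -/

section Counting

/-- The translated pieces sum to zero, so all pieces vanish. This settles the case of zero `g`,
where minimality gives no lower bound. -/
theorem TypeSemigroup.eq_zero_of_mk_le_zero {G : Type*} [Group G] {X : Type*} [TopologicalSpace X]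
    [MulAction G X] [ContinuousConstSMul G X] {f : C(X, ℕ)} (h : mk G f ≤ mk G 0) (x : X) :
    f x = 0 := by
  obtain ⟨c, m, u, t, hu, ht⟩ := (TypeSemigroup.mk_le_iff G).1 h
  have h0 : ∀ j y, u j y = 0 := by
    intro j y
    have := DFunLike.congr_fun ht (t j • y)
    rw [ContinuousMap.sum_apply, ContinuousMap.zero_apply, Finset.sum_eq_zero_iff] at this
    simpa [translate_apply] using this j (Finset.mem_univ j)
  have := DFunLike.congr_fun hu x
  simp only [ContinuousMap.sum_apply, ContinuousMap.add_apply, h0, Finset.sum_const_zero] at this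
  omega

variable {G : Type*} [Group G] {X : Type*} [TopologicalSpace X] [CompactSpace X] [MulAction G X]
  [ContinuousConstSMul G X]

/-- If `(n + 1) f ≲ n g`, then along sufficiently invariant finite sets the sums of `(n + 1) f` are
almost dominated by those of `n g`. -/
theorem exists_sum_le_of_mk_le {f g : C(X, ℕ)} {a b : ℕ}
    (h : a • TypeSemigroup.mk G f ≤ b • TypeSemigroup.mk G g) :
    ∃ (K : Finset G) (C : ℕ), ∀ (δ : ℝ) (S : Finset G), 0 ≤ δ → IsInvariantShape K δ S → ∀ x : X,
      (a : ℝ) * (∑ s ∈ S, f (s • x) : ℕ) ≤ b * (∑ s ∈ S, g (s • x) : ℕ) + C * (δ * S.card) := by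
  classical
  rw [← map_nsmul, ← map_nsmul, TypeSemigroup.mk_le_iff] at h
  obtain ⟨c, m, u, t, hu, ht⟩ := h
  choose M hM using fun j => exists_nat_bound (u j)
  -- Only invariance under the translating elements matters; exchanging the piece `u j` for its
  -- translate costs `M j * (δ * S.card)`.
  refine ⟨Finset.univ.image fun j => (t j)⁻¹, ∑ j, M j, fun δ S hδ hS x => ?_⟩
  have h1 : ∀ y, a * f y ≤ ∑ j, u j y := fun y => by
    have := DFunLike.congr_fun hu y
    simp only [ContinuousMap.sum_apply, ContinuousMap.add_apply, ContinuousMap.nsmul_apply,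
      smul_eq_mul] at this
    omega
  have h2 : ∀ y, ∑ j, u j ((t j)⁻¹ • y) = b * g y := fun y => by
    have := DFunLike.congr_fun ht y
    simpa only [ContinuousMap.sum_apply, translate_apply, ContinuousMap.nsmul_apply,
      smul_eq_mul] using this
  have h3 : ∀ j, ((∑ s ∈ S, u j (s • x) : ℕ) : ℝ) ≤
      (∑ s ∈ S, u j ((t j)⁻¹ • s • x) : ℕ) + M j * (δ * S.card) := fun j => by
    simpa only [mul_smul] using hS.sum_le_sum_mul (t := (t j)⁻¹)
      (Finset.mem_image_of_mem _ (Finset.mem_univ j)) (fun s => u j (s • x)) fun s => hM j _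
  calc (a : ℝ) * (∑ s ∈ S, f (s • x) : ℕ) ≤ ((∑ j, ∑ s ∈ S, u j (s • x) : ℕ) : ℝ) := by
        rw [Finset.sum_comm]
        rw [← Nat.cast_mul, Finset.mul_sum]
        exact Nat.cast_le.2 (Finset.sum_le_sum fun s _ => h1 _)
    _ ≤ ∑ j, ((∑ s ∈ S, u j ((t j)⁻¹ • s • x) : ℕ) + M j * (δ * S.card) : ℝ) := by
        rw [Nat.cast_sum]
        exact Finset.sum_le_sum fun j _ => h3 j
    _ = b * (∑ s ∈ S, g (s • x) : ℕ) + (∑ j, M j : ℕ) * (δ * S.card) := by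
        rw [Finset.sum_add_distrib, ← Finset.sum_mul, ← Nat.cast_sum, ← Nat.cast_sum,
          Finset.sum_comm, Finset.sum_congr rfl fun s _ => h2 (s • x), ← Finset.mul_sum,
          Nat.cast_mul]

/-- In a minimal action a nonzero function has large sums along invariant finite sets. -/
theorem exists_card_le_sum [MulAction.IsMinimal G X] {g : C(X, ℕ)} (hg : g ≠ 0) :
    ∃ (K : Finset G) (l C : ℕ), ∀ (δ : ℝ) (S : Finset G), 0 ≤ δ → IsInvariantShape K δ S →
      ∀ x : X, (S.card : ℝ) ≤ l * (∑ s ∈ S, g (s • x) : ℕ) + C * (δ * S.card) := by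
  classical
  obtain ⟨y, hy⟩ : ∃ y, g y ≠ 0 := by
    by_contra! h
    exact hg (ContinuousMap.ext h)
  obtain ⟨I, hI⟩ := exists_finset_smul_mem (G := G) (isClopen_support g).isOpen ⟨y, hy⟩
  obtain ⟨M, hM⟩ := exists_nat_bound g
  refine ⟨I.image (·⁻¹), I.card, I.card * M, fun δ S hδ hS x => ?_⟩
  -- Finitely many translates of the support of `g` cover `X`. Summing this over `S` and undoing
  -- each shift bounds `S.card` by `I.card` copies of the sum of `g`, plus an error.
  have h1 : ∀ z, 1 ≤ ∑ t ∈ I, g (t⁻¹ • z) := fun z => by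
    obtain ⟨t, ht, htz⟩ := hI z
    exact (Nat.one_le_iff_ne_zero.2 htz).trans
      (Finset.single_le_sum (f := fun t => g (t⁻¹ • z)) (fun _ _ => Nat.zero_le _) ht)
  have h2 : ∀ t ∈ I, ((∑ s ∈ S, g (t⁻¹ • s • x) : ℕ) : ℝ) ≤
      (∑ s ∈ S, g (s • x) : ℕ) + M * (δ * S.card) := fun t ht => by
    simpa only [mul_smul] using hS.sum_mul_le_sum (t := t⁻¹)
      (Finset.mem_image_of_mem _ ht) (fun s => g (s • x)) fun s => hM _
  calc (S.card : ℝ) ≤ ((∑ t ∈ I, ∑ s ∈ S, g (t⁻¹ • s • x) : ℕ) : ℝ) := by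
        rw [Finset.sum_comm, Finset.card_eq_sum_ones]
        exact Nat.cast_le.2 (Finset.sum_le_sum fun s _ => h1 _)
    _ ≤ ∑ t ∈ I, ((∑ s ∈ S, g (s • x) : ℕ) + M * (δ * S.card) : ℝ) := by
        rw [Nat.cast_sum]
        exact Finset.sum_le_sum h2
    _ = _ := by
        rw [Finset.sum_const, nsmul_eq_mul]
        push_cast
        ring

end Counting

theorem IsInvariantShape.mono {G : Type*} [Group G] {K L : Finset G} {δ ε : ℝ} {S : Finset G}
    (h : IsInvariantShape L δ S) (hKL : K ⊆ L) (hδ : δ ≤ ε) : IsInvariantShape K ε S :=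
  fun t ht => (h t (hKL ht)).trans (by gcongr)

/-- `F` and `Γ` stand for the sums of `f` and `g` along a shape of size `σ` with `q` selected
levels. The invariance error and `(n + 1) * M * q` are each at most `σ / (4 * (l + 1)) ≤ Γ / 2`, so
together they fit between `n * Γ` and `(n + 1) * Γ`. -/
theorem le_of_invariance_bounds {n l C₁ C₂ M F Γ σ q : ℕ}
    (h₁ : ((n + 1 : ℕ) : ℝ) * F ≤ n * Γ + C₁ * (1 / (4 * (l + 1) * (C₁ + C₂ + 1)) * σ))
    (h₂ : (σ : ℝ) ≤ l * Γ + C₂ * (1 / (4 * (l + 1) * (C₁ + C₂ + 1)) * σ))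
    (h₃ : (q : ℝ) < σ / (4 * (l + 1) * (n + 1) * (M + 1) : ℕ)) : F + M * q ≤ Γ := by
  have e₁ : (C₁ : ℝ) * (1 / (4 * (l + 1) * (C₁ + C₂ + 1)) * σ) ≤ σ / (4 * (l + 1)) := by
    rw [one_div, inv_mul_eq_div, mul_div_assoc', div_le_div_iff₀ (by positivity) (by positivity)]
    have : (0 : ℝ) ≤ 4 * (l + 1) * (σ * (C₂ + 1)) := by positivity
    linarith
  have e₂ : (C₂ : ℝ) * (1 / (4 * (l + 1) * (C₁ + C₂ + 1)) * σ) ≤ σ / 4 := by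
    rw [one_div, inv_mul_eq_div, mul_div_assoc', div_le_div_iff₀ (by positivity) (by positivity)]
    have : (0 : ℝ) ≤ σ * (l * (C₁ + C₂ + 1) + (C₁ + 1)) := by positivity
    linarith
  have e₃ : ((n + 1 : ℕ) : ℝ) * (M * q) ≤ σ / (4 * (l + 1)) := by
    rw [lt_div_iff₀ (by positivity)] at h₃
    rw [le_div_iff₀ (by positivity)]
    push_cast at h₃ ⊢
    have : (0 : ℝ) ≤ q * (4 * (l + 1) * (n + 1)) := by positivity
    linarith
  have e₄ : (σ : ℝ) / (4 * (l + 1)) ≤ Γ / 2 := by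
    rw [div_le_div_iff₀ (by positivity) (by positivity)]
    have : (0 : ℝ) ≤ Γ := by positivity
    linarith
  have e₅ : ((n + 1 : ℕ) : ℝ) * ((F + M * q : ℕ) : ℝ) ≤ ((n + 1 : ℕ) : ℝ) * Γ := by
    push_cast at *
    linarith
  exact Nat.cast_le.1 (le_of_mul_le_mul_left e₅ (by positivity))

theorem AlmostFinite.almostUnperforated {G : Type*} [Group G] {X : Type*} [MetricSpace X]
    [CompactSpace X] [TotallyDisconnectedSpace X] [MulAction G X] [ContinuousConstSMul G X]
    [MulAction.IsMinimal G X] (h : AlmostFinite G X) :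
    AlmostUnperforated (TypeSemigroup G X) := by
  classical
  intro a b n hn hab
  obtain ⟨f, rfl⟩ := TypeSemigroup.mk_surjective G a
  obtain ⟨g, rfl⟩ := TypeSemigroup.mk_surjective G b
  obtain ⟨M, hM⟩ := exists_nat_bound f
  obtain ⟨K₁, C₁, h₁⟩ := exists_sum_le_of_mk_le hab
  by_cases hg : g = 0
  · rw [hg, map_zero, smul_zero, ← map_nsmul, ← map_zero (TypeSemigroup.mk G)] at hab
    refine TypeSemigroup.mk_mono G fun x => ?_
    have := TypeSemigroup.eq_zero_of_mk_le_zero hab x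
    rw [ContinuousMap.nsmul_apply, smul_eq_mul] at this
    have : f x = 0 := by simpa using this
    omega
  obtain ⟨K₂, l, C₂, h₂⟩ := exists_card_le_sum (G := G) hg
  set D : ℝ := 4 * (l + 1) * (C₁ + C₂ + 1)
  have hD : 0 < D := by positivity
  set N : ℕ := 4 * (l + 1) * (n + 1) * (M + 1)
  obtain ⟨k, W, S, S', hW, R, hR, hcastle, hS, hS', hRW, hRle⟩ :=
    h.exists_clopen_castle N (K₁ ∪ K₂) (δ := 1 / D) (by positivity) (by positivity)
  have key : ∀ i x, ∑ s ∈ S i, f (s • x) + M * (S' i).card ≤ ∑ s ∈ S i, g (s • x) := by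
    intro i x
    have e₁ := h₁ (1 / D) (S i) (by positivity)
      ((hS i).mono Finset.subset_union_left le_rfl) x
    have e₂ := h₂ (1 / D) (S i) (by positivity)
      ((hS i).mono Finset.subset_union_right le_rfl) x
    refine le_of_invariance_bounds (n := n) (l := l) (C₁ := C₁) (C₂ := C₂) ?_ ?_ (hS' i)
    · simpa [D, div_mul_eq_mul_div, mul_div_assoc] using e₁
    · simpa [D, div_mul_eq_mul_div, mul_div_assoc] using e₂
  calc TypeSemigroup.mk G f
      ≤ TypeSemigroup.mk G (towerSum S hW f) + M • TypeSemigroup.mk G (clopenIndicator hR) :=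
        le_mk_towerSum_add hW hR hRW f hM
    _ ≤ TypeSemigroup.mk G (towerSum S hW f) +
        M • TypeSemigroup.mk G (∑ i, (S' i).card • clopenIndicator (hW i)) := by gcongr
    _ ≤ TypeSemigroup.mk G (towerSum S hW g) := by
        rw [← map_nsmul, ← map_add]
        refine TypeSemigroup.mk_mono G fun x => ?_
        simp only [ContinuousMap.add_apply, ContinuousMap.nsmul_apply, ContinuousMap.sum_apply,
          towerSum_apply, smul_eq_mul]
        rw [Finset.mul_sum, ← Finset.sum_add_distrib]
        refine Finset.sum_le_sum fun i _ => ?_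
        rw [← mul_assoc, ← add_mul]
        exact Nat.mul_le_mul_right _ (key i x)
    _ ≤ TypeSemigroup.mk G g := hcastle.mk_towerSum_le hW g

end CantorComparison

namespace CantorComparison

/-! ### Følner sets with robust invariance -/

section Folner

variable {G : Type*} [Group G]

open scoped Classical in
/-- A subset of almost full size of an invariant finite set is invariant. -/
theorem IsInvariantShape.of_subset {K : Finset G} {δ ε : ℝ} {S T : Finset G}
    (h : IsInvariantShape K δ T) (hST : S ⊆ T) (hε : (1 - ε) * T.card ≤ S.card) (hε0 : 0 ≤ ε)
    (hδ : 0 ≤ δ) (hε1 : ε ≤ 1 / 2) : IsInvariantShape K (2 * δ + 4 * ε) S := by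
  intro t ht
  have hsub : (t • S) ∆ S ⊆ (t • T) ∆ T ∪ (t • (T \ S) ∪ T \ S) := by
    intro x hx
    have h1 : x ∈ t • S → x ∈ t • T := fun h => Finset.smul_finset_subset_smul_finset hST h
    have h2 : x ∈ S → x ∈ T := fun h => hST h
    simp only [Finset.mem_symmDiff, Finset.mem_union, Finset.smul_finset_sdiff,
      Finset.mem_sdiff] at hx ⊢
    tauto
  have h1 : ((t • S) ∆ S).card ≤ ((t • T) ∆ T).card + ((T \ S).card + (T \ S).card) := by
    refine (Finset.card_le_card hsub).trans ((Finset.card_union_le _ _).trans ?_)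
    gcongr
    refine (Finset.card_union_le _ _).trans ?_
    rw [Finset.card_smul_finset]
  have h2 : ((T \ S).card : ℝ) = T.card - S.card := by
    rw [Finset.card_sdiff_of_subset hST, Nat.cast_sub (Finset.card_le_card hST)]
  have h3 := h t ht
  have h4 : (((t • S) ∆ S).card : ℝ) ≤ ((t • T) ∆ T).card + ((T \ S).card + (T \ S).card) := by
    exact_mod_cast h1
  have h5 : (T.card : ℝ) ≤ 2 * S.card := by
    have : (0 : ℝ) ≤ T.card := Nat.cast_nonneg _
    nlinarith
  have h6 : (T.card : ℝ) - S.card ≤ ε * T.card := by linarith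
  calc (((t • S) ∆ S).card : ℝ) ≤ (δ + 2 * ε) * T.card := by linarith
    _ ≤ (δ + 2 * ε) * (2 * S.card) := by gcongr
    _ = (2 * δ + 4 * ε) * S.card := by ring

-- For `δ < 1` each `t • T` with `t ∈ K` meets `T`, so `K ⊆ T * T⁻¹`. Invariance under a large set
-- thus forces a large shape.
open scoped Classical in
theorem IsInvariantShape.card_le_sq {K : Finset G} {δ : ℝ} {T : Finset G}
    (h : IsInvariantShape K δ T) (hδ : δ < 1) (hT : T.Nonempty) : K.card ≤ T.card ^ 2 := by
  have hsub : K ⊆ T * T⁻¹ := by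
    intro t ht
    have hT0 : (0 : ℝ) < T.card := by exact_mod_cast hT.card_pos
    obtain ⟨x, hx⟩ : (t • T ∩ T).Nonempty := by
      rw [Finset.nonempty_iff_ne_empty]
      intro hcon
      have h1 := h.card_smul_sdiff_le ht
      rw [Finset.sdiff_eq_self_of_disjoint (Finset.disjoint_iff_inter_eq_empty.2 hcon),
        Finset.card_smul_finset] at h1
      nlinarith
    rw [Finset.mem_inter, Finset.mem_smul_finset] at hx
    obtain ⟨⟨y, hy, rfl⟩, hx⟩ := hx
    exact Finset.mem_mul.2 ⟨_, hx, y⁻¹, Finset.inv_mem_inv hy, by simp⟩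
  calc K.card ≤ (T * T⁻¹).card := Finset.card_le_card hsub
    _ ≤ T.card * T⁻¹.card := Finset.card_mul_le
    _ = T.card ^ 2 := by rw [Finset.card_inv, sq]

-- A point pushed out of `T` by `w` lies in `w⁻¹ • (w • T \ T)`.
open scoped Classical in
theorem IsInvariantShape.card_boundary_le {W T : Finset G} {δ : ℝ} (h : IsInvariantShape W δ T) :
    ((T.filter fun t => ∃ w ∈ W, w * t ∉ T).card : ℝ) ≤ W.card * (δ * T.card) := by
  have h1 : (T.filter fun t => ∃ w ∈ W, w * t ∉ T) ⊆ W.biUnion fun w => w⁻¹ • (w • T \ T) := by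
    intro t ht
    obtain ⟨htT, w, hw, hwt⟩ := Finset.mem_filter.1 ht
    refine Finset.mem_biUnion.2 ⟨w, hw, ?_⟩
    rw [Finset.mem_inv_smul_finset_iff, Finset.mem_sdiff]
    exact ⟨Finset.smul_mem_smul_finset htT, hwt⟩
  calc ((T.filter fun t => ∃ w ∈ W, w * t ∉ T).card : ℝ)
      ≤ ((∑ w ∈ W, (w⁻¹ • (w • T \ T)).card : ℕ) : ℝ) :=
        Nat.cast_le.2 ((Finset.card_le_card h1).trans Finset.card_biUnion_le)
    _ = ∑ w ∈ W, ((w • T \ T).card : ℝ) := by simp [Finset.card_smul_finset]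
    _ ≤ ∑ w ∈ W, δ * T.card := Finset.sum_le_sum fun w hw => h.card_smul_sdiff_le hw
    _ = W.card * (δ * T.card) := by rw [Finset.sum_const, nsmul_eq_mul]

open scoped Classical in
/-- In an infinite amenable group there are finite sets `T` all of whose subsets of almost full size
are large and invariant, and which have small boundary with respect to a given finite set. -/
theorem IsAmenable.exists_shape [Infinite G] (hG : IsAmenable G) (K W : Finset G) {δ ε η : ℝ}
    (N : ℕ) (hδ : 0 < δ) (hε : 0 < ε) (hε1 : ε ≤ 1 / 2) (hεδ : ε ≤ δ / 8) (hη : 0 < η) :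
    ∃ T : Finset G, T.Nonempty ∧
      (∀ S ⊆ T, (1 - ε) * T.card ≤ S.card → IsInvariantShape K δ S ∧ N ≤ S.card) ∧
      ((T.filter fun t => ∃ w ∈ W, w * t ∉ T).card : ℝ) ≤ η * ((1 - ε) * T.card) := by
  -- Invariance under `L` gives `2 * N ≤ T.card`, so subsets of at least half size have `N`
  -- elements. In `ρ`, the bound `δ / 4` becomes `2 * (δ / 4) + 4 * ε ≤ δ` on such subsets, and the
  -- last term bounds the boundary by `η / 2 * T.card`.
  obtain ⟨L, hL⟩ := Infinite.exists_subset_card_eq G ((2 * N) ^ 2)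
  set ρ : ℝ := min (min (δ / 4) (1 / 2)) (η / (2 * (W.card + 1)))
  have hρ : 0 < ρ := by positivity
  obtain ⟨T, hT, hinv⟩ := hG (K ∪ W ∪ L) ρ hρ
  have hTpos : (0 : ℝ) ≤ T.card := Nat.cast_nonneg _
  have hTL : 2 * N ≤ T.card := by
    have h1 : IsInvariantShape L ρ T := hinv.mono Finset.subset_union_right le_rfl
    have h2 := h1.card_le_sq ((min_le_left _ _).trans_lt
      ((min_le_right _ _).trans_lt (by norm_num))) hT
    rw [hL] at h2
    exact (Nat.pow_le_pow_iff_left two_ne_zero).1 h2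
  have hKT : IsInvariantShape K (δ / 4) T := hinv.mono
    (Finset.subset_union_left.trans Finset.subset_union_left) ((min_le_left _ _).trans (min_le_left _ _))
  have hWT : IsInvariantShape W (η / (2 * (W.card + 1))) T := hinv.mono
    (Finset.subset_union_right.trans Finset.subset_union_left) (min_le_right _ _)
  refine ⟨T, hT, fun S hST hS => ⟨?_, ?_⟩, hWT.card_boundary_le.trans ?_⟩
  · exact (hKT.of_subset hST hS hε.le (by positivity) hε1).mono subset_rfl (by linarith)
  · have h1 : (2 * N : ℝ) ≤ T.card := by exact_mod_cast hTL
    have h2 : (N : ℝ) ≤ S.card := by nlinarith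
    exact_mod_cast h2
  · have h1 : (W.card : ℝ) * (η / (2 * (W.card + 1))) ≤ η * (1 / 2) := by
      rw [mul_div_assoc', div_le_iff₀ (by positivity)]
      linarith
    calc (W.card : ℝ) * (η / (2 * (W.card + 1)) * T.card)
        = (W.card : ℝ) * (η / (2 * (W.card + 1))) * T.card := by ring
      _ ≤ η * (1 / 2) * T.card := by gcongr
      _ ≤ η * (1 - ε) * T.card := by gcongr; linarith
      _ = η * ((1 - ε) * T.card) := by ring

end Folner

/-! ### Clopen castles of almost full measure -/

section Tilings

theorem measureReal_smul_of_mem {G : Type*} [Group G] {X : Type*} [TopologicalSpace X]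
    [MeasurableSpace X] [MulAction G X] {μ : Measure X} (hμ : μ ∈ invariantMeasures G X) (s : G)
    (V : Set X) : μ.real (s • V) = μ.real V := by
  have := hμ.2.2
  rw [measureReal_def, measure_smul, measureReal_def]

variable {G : Type*} [Group G] {X : Type*} [MetricSpace X] [MulAction G X]

/-- `B` is the union of a clopen castle with shapes in `Q` and levels of diameter less than `δ`. -/
def IsTiled (Q : Finset G → Prop) (δ : ℝ) (B : Set X) : Prop :=
  ∃ (k : ℕ) (V : Fin k → Set X) (S : Fin k → Finset G), IsCastle V S ∧ (∀ i, IsClopen (V i)) ∧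
    (∀ i, Q (S i)) ∧ (∀ i, ∀ s ∈ S i, Metric.diam (s • V i) < δ) ∧
    ⋃ i, towerUnion (S i) (V i) = B

variable {Q : Finset G → Prop} {δ : ℝ} {B : Set X}

theorem isTiled_empty : IsTiled Q δ (∅ : Set X) :=
  ⟨0, Fin.elim0, Fin.elim0, ⟨fun i => i.elim0, fun i => i.elim0⟩, fun i => i.elim0,
    fun i => i.elim0, fun i => i.elim0, by simp⟩

theorem IsTiled.union_tower (h : IsTiled Q δ B) {V : Set X} {S : Finset G} (hV : IsClopen V)
    (hS : Q S) (hVS : IsTower V S) (hdiam : ∀ s ∈ S, Metric.diam (s • V) < δ)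
    (hd : Disjoint (towerUnion S V) B) : IsTiled Q δ (B ∪ towerUnion S V) := by
  obtain ⟨k, W, R, hcastle, hW, hR, hWdiam, rfl⟩ := h
  have hd' : ∀ i, Disjoint (towerUnion S V) (towerUnion (R i) (W i)) := fun i =>
    hd.mono_right (Set.subset_iUnion (fun i => towerUnion (R i) (W i)) i)
  refine ⟨k + 1, Fin.cons V W, Fin.cons S R, ⟨?_, ?_⟩, ?_, ?_, ?_, ?_⟩
  · exact Fin.cases hVS hcastle.1
  · refine Fin.cases (Fin.cases (fun h => absurd rfl h) fun j _ => hd' j) fun i => ?_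
    refine Fin.cases (fun _ => (hd' i).symm) fun j hij => ?_
    exact hcastle.2 i j fun h => hij (h ▸ rfl)
  · exact Fin.cases hV hW
  · exact Fin.cases hS hR
  · exact Fin.cases hdiam hWdiam
  · ext x
    simp [Fin.exists_fin_succ, or_comm]

theorem IsTiled.isClopen [ContinuousConstSMul G X] (h : IsTiled Q δ B) : IsClopen B := by
  obtain ⟨k, W, R, -, hW, -, -, rfl⟩ := h
  exact isClopen_iUnion_of_finite fun i => isClopen_towerUnion _ (hW i)

/-- The points of `B` that leave `B` under some element of `W`. -/
def escape (W : Finset G) (B : Set X) : Set X := {x ∈ B | ∃ w ∈ W, w • x ∉ B}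

/-- Around each point there is a clopen set whose translates by `T` are disjoint and small. -/
theorem exists_clopen_isTower [CompactSpace X] [TotallyDisconnectedSpace X] [IsCancelSMul G X] [ContinuousConstSMul G X]
       (T : Finset G) (hδ : 0 < δ) (x : X) :
    ∃ P : Set X, IsClopen P ∧ x ∈ P ∧ IsTower P T ∧
      ∀ t ∈ T, ∀ V ⊆ P, Metric.diam (t • V) < δ := by
  have h1 : ∀ᶠ P in (nhds x).smallSets, ∀ s ∈ T, ∀ t ∈ T, s ≠ t → Disjoint (s • P) (t • P) := by
    refine (Filter.eventually_all_finset T).2 fun s _ => (Filter.eventually_all_finset T).2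
      fun t _ => ?_
    by_cases hst : s = t
    · simp [hst]
    have hne : s • x ≠ t • x := fun h => hst (IsCancelSMul.right_cancel _ _ _ h)
    obtain ⟨U, V, hU, hV, hxU, hxV, hUV⟩ := t2_separation hne
    refine Filter.eventually_smallSets.2 ⟨(s • ·) ⁻¹' U ∩ (t • ·) ⁻¹' V, Filter.inter_mem
      ((hU.preimage (continuous_const_smul s)).mem_nhds hxU)
      ((hV.preimage (continuous_const_smul t)).mem_nhds hxV), fun P hP _ => hUV.mono ?_ ?_⟩
    · rintro _ ⟨y, hy, rfl⟩
      exact (hP hy).1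
    · rintro _ ⟨y, hy, rfl⟩
      exact (hP hy).2
  have h2 : ∀ᶠ P in (nhds x).smallSets, ∀ t ∈ T, ∀ V ⊆ P, Metric.diam (t • V) < δ := by
    refine (Filter.eventually_all_finset T).2 fun t _ => Filter.eventually_smallSets.2
      ⟨(t • ·) ⁻¹' Metric.ball (t • x) (δ / 3), (Metric.isOpen_ball.preimage
        (continuous_const_smul t)).mem_nhds (Metric.mem_ball_self (by positivity)),
        fun P hP V hVP => ?_⟩
    have hsub : t • V ⊆ Metric.ball (t • x) (δ / 3) := by
      rintro _ ⟨y, hy, rfl⟩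
      exact hP (hVP hy)
    calc Metric.diam (t • V) ≤ Metric.diam (Metric.ball (t • x) (δ / 3)) :=
          Metric.diam_mono hsub Metric.isBounded_ball
      _ ≤ 2 * (δ / 3) := Metric.diam_ball (by positivity)
      _ < δ := by linarith
  obtain ⟨U, hU, hUP⟩ := Filter.eventually_smallSets.1 (h1.and h2)
  obtain ⟨O, hOU, hO, hxO⟩ := mem_nhds_iff.1 hU
  obtain ⟨P, hP, hxP, hPO⟩ := compact_exists_isClopen_in_isOpen hO hxO
  exact ⟨P, hP, hxP, (hUP P (hPO.trans hOU)).1, (hUP P (hPO.trans hOU)).2⟩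

variable [MeasurableSpace X] [BorelSpace X] [ContinuousConstSMul G X]

theorem measureReal_towerUnion {μ : Measure X} (hμ : μ ∈ invariantMeasures G X) {V : Set X}
    {S : Finset G} (hV : IsClopen V) (hVS : IsTower V S) :
    μ.real (towerUnion S V) = S.card * μ.real V := by
  have := hμ.1
  rw [towerUnion, measureReal_biUnion_finset (fun s hs t ht hst => hVS s hs t ht hst)
    (fun s _ => (isClopen_smul hV s).isOpen.measurableSet),
    Finset.sum_congr rfl fun s _ => measureReal_smul_of_mem hμ s V, Finset.sum_const, nsmul_eq_mul]

/-- A tiled set of which only a small part leaves it under `W`. -/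
def IsInvariantlyTiled (Q : Finset G → Prop) (δ : ℝ) (W : Finset G) (η : ℝ) (B : Set X) : Prop :=
  IsTiled Q δ B ∧ ∀ μ ∈ invariantMeasures G X, μ.real (escape W B) ≤ η * μ.real B

variable {W : Finset G} {η : ℝ}

-- All of `T • V` lies in the new set, so a new point can escape only from a level `t • V` with `t`
-- in the boundary of `T`. Its measure is charged to the new tower, which is disjoint from `B`, and
-- the ratio `η` survives.
open scoped Classical in
theorem IsInvariantlyTiled.union_tower (h : IsInvariantlyTiled Q δ W η B) {V : Set X}
    {S T : Finset G} (hV : IsClopen V) (hS : Q S) (hVS : IsTower V S)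
    (hdiam : ∀ s ∈ S, Metric.diam (s • V) < δ) (hd : Disjoint (towerUnion S V) B) (hST : S ⊆ T)
    (hTV : towerUnion T V ⊆ B ∪ towerUnion S V)
    (hT : ((T.filter fun t => ∃ w ∈ W, w * t ∉ T).card : ℝ) ≤ η * S.card) :
    IsInvariantlyTiled Q δ W η (B ∪ towerUnion S V) := by
  refine ⟨h.1.union_tower hV hS hVS hdiam hd, fun μ hμ => ?_⟩
  have := hμ.1
  set F := T.filter fun t => ∃ w ∈ W, w * t ∉ T
  have hsub : escape W (B ∪ towerUnion S V) ⊆ escape W B ∪ ⋃ t ∈ F, t • V := by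
    rintro x ⟨hxB | hxV, w, hw, hwx⟩
    · exact Or.inl ⟨hxB, w, hw, fun h => hwx (Or.inl h)⟩
    · right
      obtain ⟨t, ht, hxt⟩ := mem_towerUnion.1 hxV
      refine Set.mem_biUnion (x := t) (Finset.mem_filter.2 ⟨hST ht, w, hw, fun hwt => hwx ?_⟩) hxt
      refine hTV (mem_towerUnion.2 ⟨w * t, hwt, ?_⟩)
      rw [mul_smul]
      exact Set.smul_mem_smul_set hxt
  calc μ.real (escape W (B ∪ towerUnion S V))
      ≤ μ.real (escape W B) + μ.real (⋃ t ∈ F, t • V) :=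
        (measureReal_mono hsub).trans (measureReal_union_le _ _)
    _ ≤ η * μ.real B + ∑ t ∈ F, μ.real (t • V) :=
        add_le_add (h.2 μ hμ) (measureReal_biUnion_finset_le _ _)
    _ = η * μ.real B + F.card * μ.real V := by
        rw [Finset.sum_congr rfl fun s _ => measureReal_smul_of_mem hμ s V, Finset.sum_const,
          nsmul_eq_mul]
    _ ≤ η * μ.real B + η * S.card * μ.real V := by gcongr
    _ = η * μ.real (B ∪ towerUnion S V) := by
        rw [measureReal_union hd.symm (isClopen_towerUnion S hV).isOpen.measurableSet,
          measureReal_towerUnion hμ hV hVS]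
        ring

open scoped Classical in
/-- Enlarging a tiled set so that every point of a set `P` that is small with respect to `T` meets
it along a proportion `ε` of `T`. -/
theorem IsInvariantlyTiled.exists_extension (h : IsInvariantlyTiled Q δ W η B) {T : Finset G}
    {ε : ℝ} (hε : ε ≤ 1) (hη : 0 ≤ η) (hQ : ∀ S ⊆ T, (1 - ε) * T.card ≤ S.card → Q S)
    (hT : ((T.filter fun t => ∃ w ∈ W, w * t ∉ T).card : ℝ) ≤ η * ((1 - ε) * T.card))
    {P : Set X} (hP : IsClopen P) (hPT : IsTower P T)
    (hdiam : ∀ t ∈ T, ∀ V ⊆ P, Metric.diam (t • V) < δ) :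
    ∃ B', B ⊆ B' ∧ IsInvariantlyTiled Q δ W η B' ∧
      ∀ x ∈ P, ε * T.card ≤ (T.filter fun t => t • x ∈ B').card := by
  -- Points of `P` are sorted by the part `S` of `T` that sends them outside `B`. If `S` is almost
  -- all of `T`, the tower over `V S` is added and all of `T • x` is absorbed; otherwise more than
  -- `ε * T.card` translates are already in `B`.
  set V : Finset G → Set X := fun S => {x ∈ P | (T.filter fun t => t • x ∉ B) = S} with hVdef
  have hV : ∀ S ⊆ T, IsClopen (V S) := by
    intro S hST
    have : V S = P ∩ ⋂ t ∈ T, {x | t • x ∉ B ↔ t ∈ S} := by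
      ext x
      simp only [hVdef, Set.mem_ofPred_eq, Set.mem_inter_iff, Set.mem_iInter, Finset.ext_iff,
        Finset.mem_filter]
      refine and_congr_right fun _ => forall_congr' fun t => ?_
      have : t ∈ S → t ∈ T := fun h => hST h
      tauto
    rw [this]
    refine hP.inter (isClopen_biInter_finset fun t _ => ?_)
    have hB : IsClopen {x : X | t • x ∈ B} := h.1.isClopen.preimage (continuous_const_smul t)
    by_cases ht : t ∈ S
    · have e : {x : X | t • x ∉ B ↔ t ∈ S} = {x | t • x ∈ B}ᶜ := by
        ext x
        simp [ht]
      exact e ▸ hB.compl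
    · simpa [ht] using hB
  have hVP : ∀ S, V S ⊆ P := fun S => Set.sep_subset _ _
  have hVB : ∀ S, Disjoint (towerUnion S (V S)) B := by
    intro S
    rw [Set.disjoint_left]
    intro x hx hxB
    obtain ⟨s, hs, y, ⟨-, rfl⟩, rfl⟩ := mem_towerUnion.1 hx
    exact (Finset.mem_filter.1 hs).2 hxB
  have hVV : ∀ S ⊆ T, ∀ S' ⊆ T, S ≠ S' →
      Disjoint (towerUnion S (V S)) (towerUnion S' (V S')) := by
    intro S hS S' hS' hne
    rw [Set.disjoint_left]
    intro x hx hx'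
    obtain ⟨s, hs, y, hy, rfl⟩ := mem_towerUnion.1 hx
    obtain ⟨s', hs', y', hy', hyy'⟩ := mem_towerUnion.1 hx'
    have e : s' • y' = s • y := hyy'
    have hss' : s' = s := by
      by_contra hcon
      exact Set.disjoint_left.1 (hPT s' (hS' hs') s (hS hs) hcon)
        (Set.smul_mem_smul_set hy'.1) (e ▸ Set.smul_mem_smul_set hy.1)
    subst hss'
    have : y' = y := smul_left_cancel _ e
    subst this
    exact hne (hy.2.symm.trans hy'.2)
  have key : ∀ 𝒮 : Finset (Finset G), (∀ S ∈ 𝒮, S ⊆ T ∧ (1 - ε) * T.card ≤ S.card) →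
      IsInvariantlyTiled Q δ W η (B ∪ ⋃ S ∈ 𝒮, towerUnion S (V S)) := by
    intro 𝒮
    induction 𝒮 using Finset.induction_on with
    | empty => intro _; simpa using h
    | insert S 𝒮 hS ih =>
      intro h𝒮
      obtain ⟨hST, hSε⟩ := h𝒮 S (Finset.mem_insert_self _ _)
      have ih := ih fun R hR => h𝒮 R (Finset.mem_insert_of_mem hR)
      rw [Finset.set_biUnion_insert, Set.union_comm (towerUnion S (V S)), ← Set.union_assoc]
      refine ih.union_tower (T := T) (hV S hST) (hQ S hST hSε) ?_
        (fun s hs => hdiam s (hST hs) _ (hVP S)) ?_ hST ?_ (hT.trans ?_)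
      · exact fun s hs t ht hst => (hPT s (hST hs) t (hST ht) hst).mono
          (Set.smul_set_mono (hVP S)) (Set.smul_set_mono (hVP S))
      · refine Set.disjoint_union_right.2 ⟨hVB S, ?_⟩
        refine Set.disjoint_iUnion₂_right.2 fun R hR => hVV S hST R
          (h𝒮 R (Finset.mem_insert_of_mem hR)).1 fun h => hS (h ▸ hR)
      · intro x hx
        obtain ⟨t, ht, y, hy, rfl⟩ := mem_towerUnion.1 hx
        by_cases htS : t ∈ S
        · exact Or.inr (mem_towerUnion.2 ⟨t, htS, y, hy, rfl⟩)
        · refine Or.inl (Or.inl ?_)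
          by_contra hcon
          exact htS (hy.2 ▸ Finset.mem_filter.2 ⟨ht, hcon⟩)
      · gcongr
  obtain ⟨B', hBB', hVB', hB'⟩ : ∃ B', B ⊆ B' ∧
      (∀ S ⊆ T, (1 - ε) * T.card ≤ S.card → towerUnion S (V S) ⊆ B') ∧
      IsInvariantlyTiled Q δ W η B' := by
    refine ⟨_, Set.subset_union_left, fun S hST hS => ?_,
      key (T.powerset.filter fun S => (1 - ε) * T.card ≤ S.card) fun S hS => by simpa using hS⟩
    refine Set.subset_union_of_subset_right ?_ _
    exact Set.subset_biUnion_of_mem (u := fun S => towerUnion S (V S)) (by simpa using ⟨hST, hS⟩)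
  refine ⟨B', hBB', hB', fun x hx => ?_⟩
  set S := T.filter fun t => t • x ∉ B
  have hTS : (T.card : ℝ) = (T.filter fun t => t • x ∈ B).card + S.card := by
    exact_mod_cast (Finset.card_filter_add_card_filter_not (s := T) fun t => t • x ∈ B).symm
  by_cases hSε : (1 - ε) * T.card ≤ S.card
  · rw [Finset.filter_true_of_mem]
    · nlinarith [Nat.cast_nonneg (α := ℝ) T.card]
    · intro t ht
      by_cases htx : t • x ∈ B
      · exact hBB' htx
      · exact hVB' S (Finset.filter_subset _ _) hSε
          (mem_towerUnion.2 ⟨t, Finset.mem_filter.2 ⟨ht, htx⟩, x, ⟨hx, rfl⟩, rfl⟩)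
  · have hmono : (T.filter fun t => t • x ∈ B).card ≤ (T.filter fun t => t • x ∈ B').card :=
      Finset.card_le_card (Finset.monotone_filter_right T fun t _ ht => hBB' ht)
    have := (Nat.cast_le (α := ℝ)).2 hmono
    linarith

-- The average of the indicator of `B'` over `T` is at least `ε` everywhere, and equals 1 at the
-- points of `B` that do not escape under `T`. Integrating against an invariant measure gives the
-- contraction by `1 - ε`.
open scoped Classical in
theorem measureReal_compl_le {μ : Measure X} (hμ : μ ∈ invariantMeasures G X) {B B' : Set X}
    (hB : IsClopen B) (hB' : IsClopen B') (hBB' : B ⊆ B') {T : Finset G} (hT : T.Nonempty)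
    {ε η : ℝ} (hε : ε ≤ 1) (hη : 0 ≤ η) (hesc : μ.real (escape T B) ≤ η * μ.real B)
    (h : ∀ x, ε * T.card ≤ (T.filter fun t => t • x ∈ B').card) :
    1 - μ.real B' ≤ (1 - ε) * (1 - μ.real B + η) := by
  have := hμ.1
  set E := {x ∈ B | ∀ t ∈ T, t • x ∈ B} with hE
  have hEB : E = B ∩ ⋂ t ∈ T, (t • ·) ⁻¹' B := by
    ext x
    simp [hE]
  have hEm : MeasurableSet E := by
    rw [hEB]
    exact (hB.inter (isClopen_biInter_finset fun t _ =>
      hB.preimage (continuous_const_smul t))).isOpen.measurableSet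
  have hBE : μ.real B ≤ μ.real E + μ.real (escape T B) := by
    refine (measureReal_mono fun x hx => ?_).trans (measureReal_union_le _ _)
    by_cases hx' : ∀ t ∈ T, t • x ∈ B
    · exact Or.inl ⟨hx, hx'⟩
    · push Not at hx'
      exact Or.inr ⟨hx, hx'⟩
  have hT0 : (0 : ℝ) < T.card := by exact_mod_cast hT.card_pos
  have hm : ∀ t : G, MeasurableSet ((t • · : X → X) ⁻¹' B') := fun t =>
    (hB'.preimage (continuous_const_smul t)).isOpen.measurableSet
  have hpt : ∀ x, ε * T.card + (1 - ε) * T.card * E.indicator 1 x ≤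
      ∑ t ∈ T, ((t • · : X → X) ⁻¹' B').indicator (1 : X → ℝ) x := by
    intro x
    have hsum : ∑ t ∈ T, ((t • · : X → X) ⁻¹' B').indicator (1 : X → ℝ) x =
        (T.filter fun t => t • x ∈ B').card := by
      simp [Set.indicator]
    rw [hsum]
    by_cases hx : x ∈ E
    · rw [Finset.filter_true_of_mem fun t ht => hBB' (hx.2 t ht)]
      simp [hx]
      linarith
    · simpa [hx] using h x
  have hind : ∀ {A : Set X}, MeasurableSet A → Integrable (A.indicator (1 : X → ℝ)) μ :=
    fun hA => (integrable_const (1 : ℝ)).indicator hA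
  have hint := integral_mono (μ := μ)
    ((integrable_const (ε * T.card)).add ((hind hEm).const_mul ((1 - ε) * T.card)))
    (integrable_finsetSum T fun t _ => hind (hm t)) hpt
  rw [integral_add' (integrable_const _) ((hind hEm).const_mul _),
    integral_finsetSum T fun t _ => hind (hm t),
    integral_const_mul ((1 - ε) * T.card), integral_indicator_one hEm, integral_const, probReal_univ, one_smul,
    Finset.sum_congr rfl fun t _ => integral_indicator_one (hm t)] at hint
  have hinv : ∀ t : G, μ.real ((t • · : X → X) ⁻¹' B') = μ.real B' := fun t => by
    rw [Set.preimage_smul, measureReal_smul_of_mem hμ]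
  rw [Finset.sum_congr rfl fun t _ => hinv t, Finset.sum_const, nsmul_eq_mul] at hint
  have h1 : ε + (1 - ε) * μ.real E ≤ μ.real B' := by
    refine le_of_mul_le_mul_left ?_ hT0
    linarith
  have h2 : μ.real B ≤ 1 := measureReal_le_one
  have h3 : μ.real B - η ≤ μ.real E := by nlinarith
  have h4 := mul_le_mul_of_nonneg_left h3 (sub_nonneg.2 hε)
  linarith

variable [CompactSpace X] [TotallyDisconnectedSpace X] [IsCancelSMul G X]

-- Finitely many sets suited to the one-set extension cover `X`; they are treated in turn, and later
-- enlargements preserve the proportions already reached.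
open scoped Classical in
theorem IsInvariantlyTiled.exists_extension_univ (h : IsInvariantlyTiled Q δ W η B)
    {T : Finset G} {ε : ℝ} (hε : ε ≤ 1) (hη : 0 ≤ η) (hδ : 0 < δ)
    (hQ : ∀ S ⊆ T, (1 - ε) * T.card ≤ S.card → Q S)
    (hT : ((T.filter fun t => ∃ w ∈ W, w * t ∉ T).card : ℝ) ≤ η * ((1 - ε) * T.card)) :
    ∃ B', B ⊆ B' ∧ IsInvariantlyTiled Q δ W η B' ∧
      ∀ x, ε * T.card ≤ (T.filter fun t => t • x ∈ B').card := by
  choose P hP hxP hPT hdiam using fun x : X => exists_clopen_isTower (G := G) T hδ x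
  obtain ⟨I, -, hI⟩ := isCompact_univ.elim_nhds_subcover P
    fun x _ => (hP x).isOpen.mem_nhds (hxP x)
  have key : ∀ J : Finset X, ∃ B', B ⊆ B' ∧ IsInvariantlyTiled Q δ W η B' ∧
      ∀ y ∈ J, ∀ x ∈ P y, ε * T.card ≤ (T.filter fun t => t • x ∈ B').card := by
    intro J
    induction J using Finset.induction_on with
    | empty => exact ⟨B, subset_rfl, h, by simp⟩
    | insert y J _ ih =>
      obtain ⟨B₁, hB₁, h₁, hJ⟩ := ih
      obtain ⟨B₂, hB₂, h₂, hy⟩ := h₁.exists_extension hε hη hQ hT (hP y) (hPT y) (hdiam y)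
      refine ⟨B₂, hB₁.trans hB₂, h₂, fun z hz x hx => ?_⟩
      rcases Finset.mem_insert.1 hz with rfl | hz
      · exact hy x hx
      · refine (hJ z hz x hx).trans (Nat.cast_le.2 (Finset.card_le_card ?_))
        exact Finset.monotone_filter_right T fun t _ ht => hB₂ ht
  obtain ⟨B', hBB', hB', hI'⟩ := key I
  refine ⟨B', hBB', hB', fun x => ?_⟩
  obtain ⟨y, hy, hxy⟩ := Set.mem_iUnion₂.1 (hI (Set.mem_univ x))
  exact hI' y hy x hxy

/-- For free actions of amenable groups on zero-dimensional compact spaces there are clopen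
castles with invariant shapes that are uniformly almost full for all invariant measures. -/
theorem IsAmenable.exists_isTiled [Infinite G] [Nonempty X] (hG : IsAmenable G) (K : Finset G)
    (hδ : 0 < δ) (N : ℕ) {κ : ℝ} (hκ : 0 < κ) :
    ∃ B : Set X, B.Nonempty ∧ IsTiled (fun S => IsInvariantShape K δ S ∧ N ≤ S.card) δ B ∧
      ∀ μ ∈ invariantMeasures G X, 1 - μ.real B ≤ κ := by
  classical
  set ε : ℝ := min (1 / 2) (δ / 8)
  have hε : 0 < ε := by positivity
  have hε1 : ε ≤ 1 / 2 := min_le_left _ _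
  -- Stages are chosen backwards: the shape `T` of the last stage is fixed first, and the induction
  -- hypothesis is used with `W ∪ T`, so that the earlier set is already almost invariant under `T`.
  have key : ∀ (n : ℕ) (W : Finset G) (η : ℝ), 0 < η → ∃ B : Set X, (0 < n → B.Nonempty) ∧
      IsInvariantlyTiled (fun S => IsInvariantShape K δ S ∧ N ≤ S.card) δ W η B ∧
      ∀ μ ∈ invariantMeasures G X, 1 - μ.real B ≤ (1 - ε) ^ n + η := by
    intro n
    induction n with
    | zero =>
      intro W η hη
      refine ⟨∅, by simp, ⟨isTiled_empty, fun μ _ => ?_⟩, fun μ _ => ?_⟩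
      · simp [escape]
      · simp [hη.le]
    | succ n ih =>
      intro W η hη
      obtain ⟨T, hT, hTQ, hTW⟩ := hG.exists_shape K W N hδ hε hε1 (min_le_right _ _) hη
      obtain ⟨B, -, ⟨hB, hesc⟩, hBμ⟩ := ih (W ∪ T) (η / 2) (by positivity)
      have hmono : ∀ {R : Finset G}, R ⊆ W ∪ T → escape R B ⊆ escape (W ∪ T) B :=
        fun hR x hx => ⟨hx.1, hx.2.imp fun w hw => ⟨hR hw.1, hw.2⟩⟩
      have hBW : IsInvariantlyTiled (fun S => IsInvariantShape K δ S ∧ N ≤ S.card) δ W η B := by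
        refine ⟨hB, fun μ hμ => ?_⟩
        have := hμ.1
        refine (measureReal_mono (hmono Finset.subset_union_left)).trans ((hesc μ hμ).trans ?_)
        gcongr
        linarith
      obtain ⟨B', hBB', hB', hcount⟩ := hBW.exists_extension_univ (by linarith) hη.le hδ hTQ hTW
      refine ⟨B', fun _ => ?_, hB', fun μ hμ => ?_⟩
      · obtain ⟨x⟩ := ‹Nonempty X›
        have hT0 : (0 : ℝ) < T.card := by exact_mod_cast hT.card_pos
        have h1 : (0 : ℝ) < (T.filter fun t => t • x ∈ B').card :=
          (mul_pos hε hT0).trans_le (hcount x)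
        obtain ⟨t, ht⟩ := Finset.card_pos.1 (Nat.cast_pos.1 h1)
        exact ⟨_, (Finset.mem_filter.1 ht).2⟩
      · have := hμ.1
        have h1 := measureReal_compl_le hμ hB.isClopen hB'.1.isClopen hBB' hT (by linarith)
          (by positivity) ((measureReal_mono (hmono Finset.subset_union_right)).trans (hesc μ hμ))
          hcount
        have h2 := hBμ μ hμ
        calc 1 - μ.real B' ≤ (1 - ε) * (1 - μ.real B + η / 2) := h1
          _ ≤ (1 - ε) * ((1 - ε) ^ n + η / 2 + η / 2) := by
              gcongr
              linarith
          _ ≤ (1 - ε) ^ (n + 1) + η := by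
              rw [pow_succ]
              nlinarith
  obtain ⟨n, hn⟩ := exists_pow_lt_of_lt_one (half_pos hκ) (show 1 - ε < 1 by linarith)
  have hn' : (1 - ε) ^ (n + 1) ≤ (1 - ε) ^ n :=
    pow_le_pow_of_le_one (by linarith) (by linarith) (Nat.le_succ n)
  -- The extra stage guarantees a nonempty set even when `n = 0`.
  obtain ⟨B, hne, hB, hμ⟩ := key (n + 1) ∅ (κ / 2) (by positivity)
  exact ⟨B, hne (Nat.succ_pos n), hB.1, fun μ hμ' => (hμ μ hμ').trans (by linarith)⟩

end Tilings

end CantorComparison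

namespace CantorComparison

/-! ### From m-comparison to almost finiteness -/

section Spread

variable {G : Type*} [Group G] {X : Type*} [TopologicalSpace X] [MulAction G X]
  [ContinuousConstSMul G X]

/-- An `m`-coloured subequivalence into levels of a castle that have `m + 1` disjoint copies in the
castle can be made one-coloured. -/
theorem Subequiv.spread {m k : ℕ} {A : Set X} (hA : IsClosed A) {V : Fin k → Set X}
    {S : Fin k → Finset G} (hcastle : IsCastle V S) (hV : ∀ i, IsOpen (V i)) {q : Fin k → ℕ}
    (φ : ∀ i, Fin (m + 1) × Fin (q i) → G) (hφ : ∀ i, Function.Injective (φ i))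
    (hφS : ∀ i p, φ i p ∈ S i)
    (h : Subequiv G m A (⋃ i, ⋃ a, φ i (0, a) • V i)) :
    Subequiv G 0 A (⋃ i, ⋃ p, φ i p • V i) := by
  obtain ⟨𝒰, hfin, ho, hcov, s, c, hs, hd⟩ := h A hA subset_rfl
  have : Finite 𝒰 := hfin
  have key : ∀ (u : 𝒰) (i : Fin k) (a : Fin (q i)) (y : X),
      y ∈ (φ i (c u, a) * (φ i (0, a))⁻¹ * s u) • ((u : Set X) ∩ (s u)⁻¹ • φ i (0, a) • V i) →
      ∃ x ∈ (u : Set X), y = (φ i (c u, a) * (φ i (0, a))⁻¹) • s u • x ∧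
        y ∈ φ i (c u, a) • V i := by
    rintro u i a _ ⟨x, ⟨hxu, hx⟩, rfl⟩
    rw [Set.mem_inv_smul_set_iff] at hx
    refine ⟨x, hxu, by simp only [mul_smul], ?_⟩
    simp only [mul_smul]
    exact Set.smul_mem_smul_set (Set.mem_smul_set_iff_inv_smul_mem.1 hx)
  -- Each set is cut by the level `φ i (0, a)` it is sent into, and a piece of colour `c` is pushed
  -- on to `φ i (c, a)`. Different colours land in different levels; within a colour disjointness is
  -- inherited.
  refine Subequiv.of_family (ι := 𝒰 × Σ i, Fin (q i))
    (fun p => (p.1 : Set X) ∩ (s p.1)⁻¹ • φ p.2.1 (0, p.2.2) • V p.2.1)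
    (fun p => φ p.2.1 (c p.1, p.2.2) * (φ p.2.1 (0, p.2.2))⁻¹ * s p.1) (fun _ => 0) ?_ ?_ ?_ ?_
  · exact fun p => (ho p.1 p.1.2).inter (((hV _).smul _).smul _)
  · intro x hx
    obtain ⟨u, hu, hxu⟩ := hcov hx
    obtain ⟨i, hi⟩ := Set.mem_iUnion.1 (hs u hu (Set.smul_mem_smul_set hxu))
    obtain ⟨a, ha⟩ := Set.mem_iUnion.1 hi
    exact Set.mem_iUnion.2 ⟨(⟨u, hu⟩, ⟨i, a⟩), hxu, Set.mem_inv_smul_set_iff.2 ha⟩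
  · rintro ⟨u, i, a⟩ y hy
    obtain ⟨x, -, -, hy'⟩ := key u i a y hy
    exact Set.mem_iUnion₂.2 ⟨i, (c u, a), hy'⟩
  · rintro ⟨u, i, a⟩ ⟨v, j, b⟩ hne -
    rw [Set.disjoint_left]
    intro y hy hy'
    obtain ⟨x, hxu, hyx, hyV⟩ := key u i a y hy
    obtain ⟨x', hxv, hyx', hyV'⟩ := key v j b y hy'
    obtain ⟨rfl, he⟩ := hcastle.eq_of_mem (hφS _ _) (hφS _ _) hyV hyV'
    obtain ⟨hc, rfl⟩ := Prod.mk.inj (hφ i he)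
    have huv : (u : Set X) ≠ v := fun h => hne (by rw [Subtype.ext h])
    rw [hyx, ← hc] at hyx'
    have hxx' : s u • x = s v • x' := smul_left_cancel _ hyx'
    exact Set.disjoint_left.1 (hd u u.2 v v.2 huv hc) (Set.smul_mem_smul_set hxu)
      (hxx' ▸ Set.smul_mem_smul_set hxv)

end Spread

/-- A finite orbit is closed, and being dense it would be all of `X`. -/
theorem infinite_of_isMinimal (G X : Type*) [Group G] [TopologicalSpace X] [T1Space X]
    [MulAction G X] [MulAction.IsMinimal G X] [Infinite X] : Infinite G := by
  by_contra hfin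
  rw [not_infinite_iff_finite] at hfin
  obtain ⟨x⟩ := (inferInstance : Nonempty X)
  have hdense := MulAction.dense_orbit G x
  have horb : (MulAction.orbit G x).Finite := Set.finite_range _
  have huniv := hdense.closure_eq
  rw [horb.isClosed.closure_eq] at huniv
  exact Set.infinite_univ (huniv ▸ horb)

/-- Pairwise disjoint copies of a proportion of each shape of a castle. -/
theorem exists_copies {G : Type*} {S : Finset G} {m c : ℕ} (hc : 0 < c) (hS : 2 * (c * (m + 1)) ≤ S.card) :
    ∃ (q : ℕ) (φ : Fin (m + 1) × Fin q → G), 0 < q ∧ S.card ≤ 4 * (c * (m + 1)) * q ∧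
      2 * c * ((m + 1) * q) ≤ S.card ∧ Function.Injective φ ∧ ∀ p, φ p ∈ S := by
  set d := c * (m + 1) with hd
  have hdpos : 0 < d := by positivity
  -- The 2 makes the proportion of used levels strictly below `1 / c`; since `q ≥ 1`, rounding down
  -- costs at most another factor 2.
  set q := S.card / (2 * d) with hq
  have h1 : 2 * d * q ≤ S.card := Nat.mul_div_le _ _
  have h2 : S.card < 2 * d * (q + 1) := Nat.lt_mul_div_succ _ (by positivity)
  have hqpos : 0 < q := Nat.div_pos hS (by positivity)
  have h3 : 2 * c * ((m + 1) * q) = 2 * d * q := by rw [hd]; ring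
  have h4 : (m + 1) * q ≤ S.card := by
    refine le_trans ?_ (h3.trans_le h1)
    exact Nat.le_mul_of_pos_left _ (by positivity)
  obtain ⟨φ⟩ := Function.Embedding.nonempty_of_card_le (α := Fin (m + 1) × Fin q) (β := S)
    (by simpa using h4)
  refine ⟨q, fun p => φ p, hqpos, ?_, h3.trans_le h1,
    Subtype.val_injective.comp φ.injective, fun p => (φ p).2⟩
  calc S.card ≤ 2 * d * (q + 1) := h2.le
    _ ≤ 2 * d * (q + q) := by gcongr; omega
    _ = 4 * d * q := by ring

section Main

variable {G : Type*} [Group G] {X : Type*} [MetricSpace X] [CompactSpace X]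
  [TotallyDisconnectedSpace X] [MeasurableSpace X] [BorelSpace X] [MulAction G X]
  [ContinuousConstSMul G X]

theorem HasMComparison.almostFinite [Infinite G] [Nonempty X] [IsCancelSMul G X] {m : ℕ}
    (h : HasMComparison G X m) (hG : IsAmenable G) : AlmostFinite G X := by
  classical
  intro n K δ hn hδ
  set d := n * (m + 1) with hd
  have hdpos : 0 < d := by positivity
  have hd1 : (1 : ℝ) ≤ d := by exact_mod_cast hdpos
  -- The levels of colour 0 carry at least `1 / (4 * d)` of the castle, whose measure is at least `7
  -- / 8`; this exceeds the remainder bound `1 / (8 * d)`.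
  obtain ⟨B, ⟨b, hb⟩, ⟨k, V, S, hcastle, hV, hS, hdiam, rfl⟩, hμB⟩ :=
    hG.exists_isTiled (X := X) K hδ (2 * d) (κ := 1 / (8 * d)) (by positivity)
  choose q φ hq hSq hqS hφ hφS using fun i => exists_copies hn (hS i).2
  have hB : IsClopen (⋃ i, towerUnion (S i) (V i)) :=
    isClopen_iUnion_of_finite fun i => isClopen_towerUnion _ (hV i)
  have hB₀ : IsOpen (⋃ i, ⋃ a, φ i (0, a) • V i) :=
    isOpen_iUnion fun i => isOpen_iUnion fun a => (hV i).isOpen.smul _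
  have hB₀ne : (⋃ i, ⋃ a, φ i (0, a) • V i).Nonempty := by
    obtain ⟨i, hi⟩ := Set.mem_iUnion.1 hb
    obtain ⟨s, -, v, hv, -⟩ := mem_towerUnion.1 hi
    exact ⟨φ i (0, ⟨0, hq i⟩) • v, Set.mem_iUnion₂.2 ⟨i, ⟨0, hq i⟩, Set.smul_mem_smul_set hv⟩⟩
  have hμ : ∀ μ ∈ invariantMeasures G X,
      μ (⋃ i, towerUnion (S i) (V i))ᶜ < μ (⋃ i, ⋃ a, φ i (0, a) • V i) := by
    intro μ hμ
    have := hμ.1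
    have hmeas : ∀ (i : Fin k) (s : G), MeasurableSet (s • V i) := fun i s =>
      (isClopen_smul (hV i) s).isOpen.measurableSet
    have h1 : μ.real (⋃ i, towerUnion (S i) (V i)) = ∑ i, (S i).card * μ.real (V i) := by
      rw [measureReal_iUnion_fintype (fun i j hij => hcastle.2 i j hij)
        fun i => (isClopen_towerUnion _ (hV i)).isOpen.measurableSet]
      exact Finset.sum_congr rfl fun i _ => measureReal_towerUnion hμ (hV i) (hcastle.1 i)
    have h2 : μ.real (⋃ i, ⋃ a, φ i (0, a) • V i) = ∑ i, q i * μ.real (V i) := by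
      rw [measureReal_iUnion_fintype]
      · refine Finset.sum_congr rfl fun i _ => ?_
        rw [measureReal_iUnion_fintype _ fun a => hmeas i _,
          Finset.sum_congr rfl fun a _ => measureReal_smul_of_mem hμ _ _]
        · simp
        · intro a a' haa'
          refine hcastle.1 i _ (hφS i _) _ (hφS i _) fun he => haa' ?_
          exact (Prod.mk.inj (hφ i he)).2
      · refine fun i j hij => (hcastle.2 i j hij).mono ?_ ?_
        · exact Set.iUnion_subset fun a x hx => mem_towerUnion.2 ⟨_, hφS i _, hx⟩
        · exact Set.iUnion_subset fun a x hx => mem_towerUnion.2 ⟨_, hφS j _, hx⟩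
      · exact fun i => MeasurableSet.iUnion fun a => hmeas i _
    have h3 : μ.real (⋃ i, towerUnion (S i) (V i)) ≤
        4 * d * μ.real (⋃ i, ⋃ a, φ i (0, a) • V i) := by
      rw [h1, h2, Finset.mul_sum]
      refine Finset.sum_le_sum fun i _ => ?_
      rw [← mul_assoc]
      gcongr
      exact_mod_cast hSq i
    have h4 := hμB μ hμ
    have h5 : μ.real (⋃ i, towerUnion (S i) (V i))ᶜ <
        μ.real (⋃ i, ⋃ a, φ i (0, a) • V i) := by
      rw [probReal_compl_eq_one_sub hB.isOpen.measurableSet]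
      refine h4.trans_lt ?_
      have h6 : (1 : ℝ) / (8 * d) ≤ 1 / 8 := by
        rw [div_le_div_iff₀ (by positivity) (by positivity)]
        linarith
      rw [div_lt_iff₀ (by positivity)]
      linarith
    exact (ENNReal.toReal_lt_toReal (measure_ne_top _ _) (measure_ne_top _ _)).1 h5
  refine ⟨k, V, S, hcastle, fun i => (hV i).isOpen, fun i => (hS i).1, hdiam,
    fun i => Finset.univ.image (φ i), fun i s hs => ?_, fun i => ?_, ?_⟩
  · obtain ⟨p, -, rfl⟩ := Finset.mem_image.1 hs
    exact hφS i p
  · rw [Finset.card_image_of_injective _ (hφ i), lt_div_iff₀ (by positivity)]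
    have h1 : (m + 1) * q i * n < (S i).card := by
      have h2 : 0 < n * ((m + 1) * q i) := by
        have := hq i
        positivity
      have := hqS i
      nlinarith
    have h3 : (Finset.univ : Finset (Fin (m + 1) × Fin (q i))).card = (m + 1) * q i := by simp
    rw [h3]
    exact_mod_cast h1
  · have htarget : (⋃ i, towerUnion (Finset.univ.image (φ i)) (V i)) = ⋃ i, ⋃ p, φ i p • V i := by
      refine Set.iUnion_congr fun i => ?_
      ext x
      simp [mem_towerUnion]
    rw [htarget]
    -- Comparison speaks only of nonempty sets, so a castle filling `X` is treated apart.
    rcases Set.eq_empty_or_nonempty (⋃ i, towerUnion (S i) (V i))ᶜ with hempty | hne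
    · rw [hempty]
      exact Subequiv.of_family (ι := Empty) Empty.elim Empty.elim Empty.elim (fun i => i.elim)
        (Set.empty_subset _) (fun i => i.elim) (fun i => i.elim)
    · exact Subequiv.spread hB.compl.isClosed hcastle (fun i => (hV i).isOpen) φ hφ hφS
        (h _ _ hB.compl.isOpen hB₀ hne hB₀ne hμ)

end Main

end CantorComparison

/-- The implications between almost finiteness, almost unperforation of the clopen type semigroup,
comparison, and `m`-comparison for a free minimal action `G ↷ X` of a countable discrete group on
the Cantor set, and their equivalence when `G` is amenable and `E_G(X)` is finite. -/
theorem mainTheorem10 {G : Type*} [Group G] [Countable G]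
    {X : Type*} [MetricSpace X] [MeasurableSpace X] [BorelSpace X]
    (hX : Nonempty (X ≃ₜ cantorSet))
    [MulAction G X] [ContinuousConstSMul G X] [IsCancelSMul G X] [MulAction.IsMinimal G X] :
    (CantorComparison.AlmostFinite G X →
      CantorComparison.AlmostUnperforated (CantorComparison.TypeSemigroup G X)) ∧
    (CantorComparison.AlmostUnperforated (CantorComparison.TypeSemigroup G X) →
      CantorComparison.HasComparison G X) ∧
    (CantorComparison.HasComparison G X → ∀ m : ℕ, CantorComparison.HasMComparison G X m) ∧
    ((∀ m : ℕ, CantorComparison.HasMComparison G X m) →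
      ∃ m : ℕ, CantorComparison.HasMComparison G X m) ∧
    (CantorComparison.IsAmenable G → (CantorComparison.ergodicMeasures G X).Finite →
      List.TFAE [
        CantorComparison.AlmostFinite G X,
        CantorComparison.AlmostUnperforated (CantorComparison.TypeSemigroup G X),
        CantorComparison.HasComparison G X,
        ∀ m : ℕ, CantorComparison.HasMComparison G X m,
        ∃ m : ℕ, CantorComparison.HasMComparison G X m]) := by
  obtain ⟨e⟩ := hX
  let e' : X ≃ₜ (ℕ → Bool) := e.trans cantorSetHomeomorphNatToBool
  have : CompactSpace X := e'.symm.compactSpace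
  have : TotallyDisconnectedSpace X :=
    e'.isEmbedding.isTotallyDisconnected_range.1 (isTotallyDisconnected_of_totallyDisconnectedSpace _)
  have : Infinite X := e'.toEquiv.infinite_iff.2 inferInstance
  have : Infinite G := CantorComparison.infinite_of_isMinimal G X
  have h₁ : CantorComparison.AlmostFinite G X →
      CantorComparison.AlmostUnperforated (CantorComparison.TypeSemigroup G X) :=
    fun h => h.almostUnperforated
  have h₂ : CantorComparison.AlmostUnperforated (CantorComparison.TypeSemigroup G X) →
      CantorComparison.HasComparison G X := fun h => h.hasComparison
  have h₃ : CantorComparison.HasComparison G X →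
      ∀ m : ℕ, CantorComparison.HasMComparison G X m := fun h => h.hasMComparison
  have h₄ : (∀ m : ℕ, CantorComparison.HasMComparison G X m) →
      ∃ m : ℕ, CantorComparison.HasMComparison G X m := fun h => ⟨0, h 0⟩
  refine ⟨h₁, h₂, h₃, h₄, fun hG _ => ?_⟩
  tfae_have 1 → 2 := h₁
  tfae_have 2 → 3 := h₂
  tfae_have 3 → 4 := h₃
  tfae_have 4 → 5 := h₄
  tfae_have 5 → 1 := fun ⟨_, hm⟩ => hm.almostFinite hG
  tfae_finish
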